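/- Let $\mathcal H=\mathbb C^{d_1}\otimes\cdots\otimes\mathbb C^{d_n}$ be the Hilbert space of $n$ parties (for instance $d_1=\dots=d_n=d$), let states $|\psi\rangle,|\phi\rangle\in\mathcal H$ be unit vectors and write $\psi=|\psi\rangle\langle\psi|$. Let $F(\rho,\sigma)=(\operatorname{tr}\sqrt{\sqrt\rho\,\sigma\sqrt\rho})^2$ and $F_{LU}(\rho,\sigma)=\max_U F(\rho,U\sigma U^\dagger)$, the maximum being over local unitaries $U=U_1\otimes\cdots\otimes U_n$. An LOCC transformation with finite outcome set $M$ is a family $\Lambda=(\Lambda_c)_{c\in M}$ of linear maps on operators on $\mathcal H$, identified with $X\mapsto\sum_c\Lambda_c(X)\otimes|c\rangle\langle c|$, for which there is a sequence of finite-round protocols, the first of which does nothing and each later one of which adds one round to its predecessor (followed by an optional coarse-graining of the outcomes), such that suitable coarse-grainings of these protocols converge to $\Lambda$ in diamond norm. In a round, one party, chosen depending on the previous outcomes, performs a local measurement with finitely many outcomes and announces the outcome, and the other parties then apply local channels that may depend on it. An LOCC map is an LOCC transformation with one outcome. A map $\mathcal E$ is separable, $\mathcal E\in\mathrm{SEP}$,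 if $\mathcal E(X)=\sum_{a=1}^r K_aXK_a^\dagger$ with finitely many product operators $K_a=K_{a,1}\otimes\cdots\otimes K_{a,n}$ and $\sum_aK_a^\dagger K_a=\mathbb 1$. For $\delta,\varepsilon\ge0$ let $T^{\delta,\varepsilon}_{ens}(\psi,\phi)$ be the set of LOCC transformations $\Lambda$ for which there are a state $|\tilde\psi\rangle\in\mathcal H$ with $F_{LU}(\tilde\psi,\psi)\ge1-\delta$ and a finite ensemble $\{(p_c,|\chi_c\rangle)\}$ of pure states with $\Lambda(\tilde\psi)=\sum_cp_c|\chi_c\rangle\langle\chi_c|\otimes|c\rangle\langle c|$ and $\sum_cp_cF_{LU}(\chi_c,\phi)\ge1-\varepsilon$. Let $$A(\psi)=\{|\phi\rangle\in\mathcal H:\ \forall\varepsilon>0,\ T^{0,\varepsilon}_{ens}(\psi,\phi)\neq\emptyset\}.$$ Then, for every state $|\psi\rangle\in\mathcal H$, 1. $A(\psi)$ is the set of states $|\phi\rangle$ for which there is a sequence $(\Lambda_i)_{i\in\mathbb N}$ of LOCC maps such that $\Lambda_i(\psi)\to\phi$ in trace distance; 2. $A(\psi)\subseteq\{|\phi\rangle\in\mathcal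 H:\ \exists\,\mathcal E\in\mathrm{SEP},\ \mathcal E(\psi)=\phi\}$. -/

import Mathlib

open Filter Topology
open scoped ENNReal

namespace LocalOps

/-! ### States, operators and maps on `ℂ^{d 1} ⊗ ⋯ ⊗ ℂ^{d n}` -/

/-- Labels of the product basis of `ℂ^{d 1} ⊗ ⋯ ⊗ ℂ^{d n}`. -/
abbrev Idx {n : ℕ} (d : Fin n → ℕ) : Type := ∀ i, Fin (d i)

/-- Operators on the `n`-party Hilbert space, as matrices in the product basis. -/
abbrev Op {n : ℕ} (d : Fin n → ℕ) : Type := Matrix (Idx d) (Idx d) ℂ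

/-- Linear maps taking operators on the Hilbert space to operators on it. -/
abbrev SuperOp {n : ℕ} (d : Fin n → ℕ) : Type := Op d →ₗ[ℂ] Op d

/-- Pure states: unit vectors of the `n`-party Hilbert space. -/
abbrev PureState {n : ℕ} (d : Fin n → ℕ) : Type :=
  {ψ : EuclideanSpace ℂ (Idx d) // ‖ψ‖ = 1}

/-- The rank-one density matrix `|ψ⟩⟨ψ|`. -/
def PureState.dm {n : ℕ} {d : Fin n → ℕ} (ψ : PureState d) : Op d :=
  Matrix.of fun x y => ψ.1 x * star (ψ.1 y)

/-- The product operator `A 1 ⊗ ⋯ ⊗ A n`. -/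
def prodOp {n : ℕ} {d : Fin n → ℕ} (A : ∀ i, Matrix (Fin (d i)) (Fin (d i)) ℂ) : Op d :=
  Matrix.of fun x y => ∏ i, A i (x i) (y i)

/-- The completely positive map `X ↦ K X K†`. -/
def conjMap {n : ℕ} {d : Fin n → ℕ} (K : Op d) : SuperOp d where
  toFun X := K * X * K.conjTranspose
  map_add' X Y := by rw [mul_add, add_mul]
  map_smul' c X := by simp

/-! ### Trace norm, trace distance, fidelity, diamond norm -/

/-- The square root of a positive semidefinite matrix. -/
noncomputable def matSqrt {a : Type} [Fintype a] [DecidableEq a] (A : Matrix a a ℂ) :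
    Matrix a a ℂ :=
  cfc Real.sqrt A

/-- `‖X‖₁ = tr √(X† X)`. -/
noncomputable def traceNorm {a : Type} [Fintype a] [DecidableEq a] (X : Matrix a a ℂ) : ℝ :=
  (matSqrt (X.conjTranspose * X)).trace.re

/-- `D(ρ, σ) = ½ ‖ρ - σ‖₁`. -/
noncomputable def traceDist {a : Type} [Fintype a] [DecidableEq a] (ρ σ : Matrix a a ℂ) : ℝ :=
  1 / 2 * traceNorm (ρ - σ)

/-- `F(ρ, σ) = (tr √(√ρ σ √ρ))²`. -/
noncomputable def fidelity {a : Type} [Fintype a] [DecidableEq a] (ρ σ : Matrix a a ℂ) : ℝ :=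
  (matSqrt (matSqrt ρ * σ * matSqrt ρ)).trace.re ^ 2

/-- The fidelity optimized over local unitaries,
`F_LU(ρ, σ) = max_U F(ρ, U σ U†)` with `U = U 1 ⊗ ⋯ ⊗ U n`. -/
noncomputable def fidelityLU {n : ℕ} {d : Fin n → ℕ} (ρ σ : Op d) : ℝ :=
  ⨆ U : ∀ i, Matrix.unitaryGroup (Fin (d i)) ℂ,
    fidelity ρ (conjMap (prodOp fun i => (U i : Matrix (Fin (d i)) (Fin (d i)) ℂ)) σ)

/-- The average LU-optimized fidelity of a finite ensemble `{(p c, χ c)}` of pure states with `φ`. -/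
noncomputable def avgFidelity {n : ℕ} {d : Fin n → ℕ} {m : ℕ} (p : Fin m → ℝ)
    (χ : Fin m → PureState d) (φ : PureState d) : ℝ :=
  ∑ c, p c * fidelityLU (χ c).dm φ.dm

/-- `(Φ ⊗ id_k)(X)`, where `X` acts on the tensor product of the input space with `ℂ^k`. -/
def ampl {a b : Type} (k : ℕ) (Φ : Matrix a a ℂ →ₗ[ℂ] Matrix b b ℂ)
    (X : Matrix (a × Fin k) (a × Fin k) ℂ) : Matrix (b × Fin k) (b × Fin k) ℂ :=
  Matrix.of fun x y => Φ (Matrix.of fun s t => X (s, x.2) (t, y.2)) x.1 y.1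

/-- The diamond norm `sup_k sup {‖(Φ ⊗ id_k)(X)‖₁ : ‖X‖₁ ≤ 1}`. -/
noncomputable def diamondNorm {a b : Type} [Fintype a] [DecidableEq a] [Fintype b] [DecidableEq b]
    (Φ : Matrix a a ℂ →ₗ[ℂ] Matrix b b ℂ) : ℝ≥0∞ :=
  ⨆ (k : ℕ) (X : Matrix (a × Fin k) (a × Fin k) ℂ) (_ : traceNorm X ≤ 1),
    ENNReal.ofReal (traceNorm (ampl k Φ X))

/-! ### LOCC -/

/-- One round with outcome set `O`: `party` performs a measurement (a local quantum instrument)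
and announces its outcome `o`, and every other party then applies a local channel that may depend
on `o`. For each `o` and each party `i`, `kraus o i` lists the Kraus operators of the completely
positive map applied by `i`. -/
structure Round {n : ℕ} (d : Fin n → ℕ) (O : Type) [Fintype O] where
  party : Fin n
  rank : O → Fin n → ℕ
  kraus : ∀ (o : O) (i : Fin n), Fin (rank o i) → Matrix (Fin (d i)) (Fin (d i)) ℂ
  measurement : ∑ o, ∑ a, (kraus o party a).conjTranspose * kraus o party a = 1
  channel : ∀ o i, i ≠ party → ∑ a, (kraus o i a).conjTranspose * kraus o i a = 1

/-- The tensor product over all parties of the local completely positive maps applied when the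
outcome of the round is `o`. -/
noncomputable def Round.op {n : ℕ} {d : Fin n → ℕ} {O : Type} [Fintype O] (R : Round d O)
    (o : O) : SuperOp d :=
  ∑ a : ∀ i, Fin (R.rank o i), conjMap (prodOp fun i => R.kraus o i (a i))

open Classical in
/-- Relabelling (coarse-graining) of the outcomes of an instrument along `g`. -/
noncomputable def coarse {n : ℕ} {d : Fin n → ℕ} {O M : Type} [Fintype O]
    (J : O → SuperOp d) (g : O → M) (c : M) : SuperOp d :=
  ∑ o with g o = c, J o

/-- `J'` arises from the instrument `J` by one further round, which may depend on the outcome of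
`J`, followed by a coarse-graining of the joint outcomes. -/
def Linked {n : ℕ} {d : Fin n → ℕ} {O O' : Type} [Fintype O]
    (J : O → SuperOp d) (J' : O' → SuperOp d) : Prop :=
  ∃ (P : O → Type) (_ : ∀ o, Fintype (P o)) (R : ∀ o, Round d (P o)) (f : (Σ o, P o) → O'),
    J' = coarse (fun x : (Σ o, P o) => (R x.1).op x.2 ∘ₗ J x.1) f

/-- The map `X ↦ ∑ c, Λ c X ⊗ |c⟩⟨c|` that keeps the outcome in a classical register. -/
def record {n : ℕ} {d : Fin n → ℕ} {M : Type} [DecidableEq M] (Λ : M → SuperOp d) :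
    Op d →ₗ[ℂ] Matrix (Idx d × M) (Idx d × M) ℂ where
  toFun X := Matrix.of fun x y => if x.2 = y.2 then Λ x.2 X x.1 y.1 else 0
  map_add' X Y := by ext x y; simp only [Matrix.of_apply, Matrix.add_apply, map_add]; split <;> simp
  map_smul' c X := by
    ext x y; simp only [Matrix.of_apply, Matrix.smul_apply, map_smul, RingHom.id_apply]
    split <;> simp

/-- LOCC instruments with outcome set `M`, possibly with infinitely many rounds. There is a sequence
of finite-round protocols in which `J 0` does nothing and `J (ν + 1)` adds one round to `J ν`, such
that suitable coarse-grainings of `J ν` converge to `Λ` in diamond norm. All measurements have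
finitely many outcomes. -/
def IsLOCC {n : ℕ} {d : Fin n → ℕ} {M : Type} [Fintype M] [DecidableEq M]
    (Λ : M → SuperOp d) : Prop :=
  ∃ (O : ℕ → Type) (_ : ∀ ν, Fintype (O ν)) (J : ∀ ν, O ν → SuperOp d) (g : ∀ ν, O ν → M),
    (∃ o₀ : O 0, (∀ o, o = o₀) ∧ J 0 o₀ = LinearMap.id) ∧
    (∀ ν, Linked (J ν) (J (ν + 1))) ∧
    Tendsto (fun ν => diamondNorm (record (coarse (J ν) (g ν)) - record Λ)) atTop (𝓝 0)

/-- LOCC maps: LOCC instruments with a single outcome. -/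
def IsLOCCMap {n : ℕ} {d : Fin n → ℕ} (Λ : SuperOp d) : Prop :=
  IsLOCC fun _ : Unit => Λ

/-- Separable maps: trace-preserving maps with finitely many Kraus operators, all of them product
operators. -/
def IsSEP {n : ℕ} {d : Fin n → ℕ} (E : SuperOp d) : Prop :=
  ∃ (r : ℕ) (K : Fin r → ∀ i, Matrix (Fin (d i)) (Fin (d i)) ℂ),
    ∑ a, (prodOp (K a)).conjTranspose * prodOp (K a) = 1 ∧
    E = ∑ a, conjMap (prodOp (K a))

/-! ### Approximate ensemble transformations -/

/-- `Λ(ψ)` is the ensemble `{(p c, χ c)}` of pure states, that is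
`Λ(|ψ⟩⟨ψ|) = ∑ c, p c |χ c⟩⟨χ c| ⊗ |c⟩⟨c|`. -/
def Outputs {n : ℕ} {d : Fin n → ℕ} {m : ℕ} (Λ : Fin m → SuperOp d) (ψ : PureState d)
    (p : Fin m → ℝ) (χ : Fin m → PureState d) : Prop :=
  (∀ c, 0 ≤ p c) ∧ ∑ c, p c = 1 ∧ ∀ c, Λ c ψ.dm = (p c : ℂ) • (χ c).dm

/-- `T_ens^{δ,ε}(ψ, φ)`: the LOCC transformations that take some pure state `δ`-close to `ψ` to a
finite ensemble of pure states that is on average `ε`-close to `φ`. An element consists of the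
number of outcomes and the instrument. -/
def ensTransf {n : ℕ} {d : Fin n → ℕ} (δ ε : ℝ) (ψ φ : PureState d) :
    Set (Σ m : ℕ, Fin m → SuperOp d) :=
  {Λ | IsLOCC Λ.2 ∧ ∃ (ψ' : PureState d) (p : Fin Λ.1 → ℝ) (χ : Fin Λ.1 → PureState d),
    1 - δ ≤ fidelityLU ψ'.dm ψ.dm ∧ Outputs Λ.2 ψ' p χ ∧ 1 - ε ≤ avgFidelity p χ φ}

/-- `A(ψ)`: the states reachable from `ψ` by approximate ensemble transformations (with `δ = 0`)
for every `ε > 0`. -/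
def limitReachable {n : ℕ} {d : Fin n → ℕ} (ψ : PureState d) : Set (PureState d) :=
  {φ | ∀ ε : ℝ, 0 < ε → ∃ Λ, Λ ∈ ensTransf 0 ε ψ φ}

end LocalOps

open LocalOps

/-! Both claims reduce to finite-round protocols. For pure φ the overlap ⟨φ|ρ|φ⟩ is the fidelity and
is linear in ρ, so averaging over an ensemble and forgetting its labels give the same number.

From ensembles to maps: after outcome c, the parties undo a nearly optimal local unitary V_c from
`fidelityLU` and then forget c. The average LU-fidelity becomes, up to a small error, the overlap of
the resulting state with φ. Since the condition is open and linear maps are continuous here, the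
LOCC limit can be replaced by a finite-round protocol, and ψ' by a local-unitary image of ψ
(`exists_finiteRound_overlap`). The output is a mixture of pure states, hence of purity at most 1,
so overlap near 1 forces convergence to φ (`hsSq_mixture_sub_dm_le`).

From maps to ensembles: every finite-round protocol is a coarse-graining of one whose outcomes each
carry a single product Kraus operator (`Refinable.linked`). Announcing all outcomes sends ψ to an
ensemble of pure states with the same average overlap with φ.

Separability: the same refinement shows that finite-round maps are separable. The states reachable
from ψ by separable maps form a closed set (`isClosed_setOf_isSEP_apply`): Carathéodory bounds the
number of Kraus operators, and the normalized parameters range over a compact set. Hence the limit φ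
is itself reached. -/

open scoped ComplexOrder

/-! ### Trace norm and square roots of matrices -/

section MatrixNorms

variable {a : Type} [Fintype a]

/-- The squared Hilbert–Schmidt norm. -/
noncomputable def hsSq (X : Matrix a a ℂ) : ℝ := ∑ x, ∑ y, ‖X x y‖ ^ 2

theorem hsSq_nonneg (X : Matrix a a ℂ) : 0 ≤ hsSq X := by
  unfold hsSq; positivity

theorem trace_conjTranspose_mul_self_eq_hsSq (X : Matrix a a ℂ) :
    (X.conjTranspose * X).trace = (hsSq X : ℂ) := by
  simp only [Matrix.trace, Matrix.diag, Matrix.mul_apply, Matrix.conjTranspose_apply, hsSq]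
  rw [Finset.sum_comm]
  push_cast
  refine Finset.sum_congr rfl fun x _ => Finset.sum_congr rfl fun y _ => ?_
  rw [← Complex.conj_mul']; rfl

theorem norm_apply_le_sqrt_hsSq (X : Matrix a a ℂ) (x y : a) : ‖X x y‖ ≤ √(hsSq X) := by
  apply Real.le_sqrt_of_sq_le
  calc ‖X x y‖ ^ 2 ≤ ∑ y, ‖X x y‖ ^ 2 :=
        Finset.single_le_sum (f := fun y => ‖X x y‖ ^ 2) (fun _ _ => by positivity)
          (Finset.mem_univ y)
    _ ≤ hsSq X :=
        Finset.single_le_sum (f := fun x => ∑ y, ‖X x y‖ ^ 2) (fun _ _ => by positivity)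
          (Finset.mem_univ x)

theorem continuous_hsSq : Continuous (hsSq : Matrix a a ℂ → ℝ) := by
  unfold hsSq; fun_prop

variable [DecidableEq a]

theorem trace_matSqrt {A : Matrix a a ℂ} (hA : A.IsHermitian) :
    (matSqrt A).trace.re = ∑ i, √(hA.eigenvalues i) := by
  rw [matSqrt, hA.cfc_eq, Matrix.IsHermitian.cfc, Unitary.conjStarAlgAut_apply,
    Matrix.trace_mul_cycle, Unitary.coe_star_mul_self, one_mul, Matrix.trace_diagonal]
  simp

theorem traceNorm_eq_sum (X : Matrix a a ℂ) :
    traceNorm X = ∑ i, √((Matrix.isHermitian_conjTranspose_mul_self X).eigenvalues i) :=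
  trace_matSqrt _

theorem hsSq_eq_sum_eigenvalues (X : Matrix a a ℂ) :
    hsSq X = ∑ i, (Matrix.isHermitian_conjTranspose_mul_self X).eigenvalues i := by
  have h := (Matrix.isHermitian_conjTranspose_mul_self X).trace_eq_sum_eigenvalues
  rw [trace_conjTranspose_mul_self_eq_hsSq] at h
  apply Complex.ofReal_injective
  rw [h]; simp

theorem traceNorm_nonneg (X : Matrix a a ℂ) : 0 ≤ traceNorm X := by
  rw [traceNorm_eq_sum]; positivity

/-- For the vector of singular values, the ℓ² norm is at most the ℓ¹ norm. -/
theorem sqrt_hsSq_le_traceNorm (X : Matrix a a ℂ) : √(hsSq X) ≤ traceNorm X := by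
  have hpos := (Matrix.posSemidef_conjTranspose_mul_self X).eigenvalues_nonneg
  rw [Real.sqrt_le_left (traceNorm_nonneg X), traceNorm_eq_sum, hsSq_eq_sum_eigenvalues]
  calc _ = ∑ i, √((Matrix.isHermitian_conjTranspose_mul_self X).eigenvalues i) ^ 2 :=
        Finset.sum_congr rfl fun i _ => (Real.sq_sqrt (hpos i)).symm
    _ ≤ _ := Finset.sum_sq_le_sq_sum_of_nonneg fun i _ => Real.sqrt_nonneg _

theorem norm_apply_le_traceNorm (X : Matrix a a ℂ) (x y : a) : ‖X x y‖ ≤ traceNorm X :=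
  (norm_apply_le_sqrt_hsSq X x y).trans (sqrt_hsSq_le_traceNorm X)

/-- Each singular value is at most the Hilbert–Schmidt norm. The crude dimension factor is harmless,
as only convergence is at stake. -/
theorem traceNorm_le_card_mul (X : Matrix a a ℂ) :
    traceNorm X ≤ Fintype.card a * √(hsSq X) := by
  have hpos := (Matrix.posSemidef_conjTranspose_mul_self X).eigenvalues_nonneg
  rw [traceNorm_eq_sum, hsSq_eq_sum_eigenvalues]
  calc _ ≤ ∑ _i : a, √(∑ i, (Matrix.isHermitian_conjTranspose_mul_self X).eigenvalues i) :=
        Finset.sum_le_sum fun i hi => Real.sqrt_le_sqrt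
          (Finset.single_le_sum (fun j _ => hpos j) hi)
    _ = _ := by simp

theorem tendsto_of_traceNorm_sub {ι : Type*} {l : Filter ι} {X : ι → Matrix a a ℂ}
    {Y : Matrix a a ℂ} (h : Tendsto (fun i => traceNorm (X i - Y)) l (𝓝 0)) :
    Tendsto X l (𝓝 Y) := by
  refine tendsto_pi_nhds.2 fun x => tendsto_pi_nhds.2 fun y => ?_
  rw [tendsto_iff_norm_sub_tendsto_zero]
  exact squeeze_zero (fun _ => norm_nonneg _) (fun i => norm_apply_le_traceNorm (X i - Y) x y) h

theorem tendsto_traceNorm_sub_of_hsSq {ι : Type*} {l : Filter ι} {X : ι → Matrix a a ℂ}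
    {Y : Matrix a a ℂ} (h : Tendsto (fun i => hsSq (X i - Y)) l (𝓝 0)) :
    Tendsto (fun i => traceNorm (X i - Y)) l (𝓝 0) := by
  refine squeeze_zero (fun _ => traceNorm_nonneg _) (fun i => traceNorm_le_card_mul _) ?_
  simpa using (h.sqrt).const_mul (Fintype.card a : ℝ)

theorem tendsto_of_hsSq_sub {ι : Type*} {l : Filter ι} {X : ι → Matrix a a ℂ}
    {Y : Matrix a a ℂ} (h : Tendsto (fun i => hsSq (X i - Y)) l (𝓝 0)) :
    Tendsto X l (𝓝 Y) :=
  tendsto_of_traceNorm_sub (tendsto_traceNorm_sub_of_hsSq h)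

theorem matSqrt_mul_self {B : Matrix a a ℂ} (hB : B.PosSemidef) : matSqrt (B * B) = B := by
  have hsa : IsSelfAdjoint B := hB.1
  have hspec : ∀ x ∈ spectrum ℝ B, 0 ≤ x := by
    intro x hx
    rw [hB.1.spectrum_real_eq_range_eigenvalues] at hx
    obtain ⟨i, rfl⟩ := hx
    exact hB.eigenvalues_nonneg i
  rw [matSqrt, ← sq, ← cfc_comp_pow Real.sqrt 2 B]
  conv_rhs => rw [← cfc_id' ℝ B]
  exact cfc_congr fun x hx => Real.sqrt_sq (hspec x hx)

theorem matSqrt_of_projection {P : Matrix a a ℂ} (hP : P.conjTranspose = P) (hPP : P * P = P) :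
    matSqrt P = P := by
  have : P.PosSemidef := by
    have h := Matrix.posSemidef_conjTranspose_mul_self P
    rwa [hP, hPP] at h
  conv_lhs => rw [← hPP]
  exact matSqrt_mul_self this

theorem matSqrt_smul_projection {P : Matrix a a ℂ} (hP : P.conjTranspose = P) (hPP : P * P = P)
    {c : ℝ} (hc : 0 ≤ c) : matSqrt (((c ^ 2 : ℝ) : ℂ) • P) = (c : ℂ) • P := by
  have hpos : P.PosSemidef := by
    have h := Matrix.posSemidef_conjTranspose_mul_self P
    rwa [hP, hPP] at h
  have h : ((c ^ 2 : ℝ) : ℂ) • P = ((c : ℂ) • P) * ((c : ℂ) • P) := by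
    rw [Matrix.smul_mul, Matrix.mul_smul, hPP, smul_smul]; push_cast; ring_nf
  rw [h]
  exact matSqrt_mul_self (hpos.smul (by exact_mod_cast hc))

theorem traceNorm_of_projection {P : Matrix a a ℂ} (hP : P.conjTranspose = P) (hPP : P * P = P) :
    traceNorm P = P.trace.re := by
  rw [traceNorm, hP, hPP, matSqrt_of_projection hP hPP]

theorem traceNorm_zero : traceNorm (0 : Matrix a a ℂ) = 0 := by
  rw [traceNorm_of_projection (by simp) (by simp)]; simp

end MatrixNorms

/-! ### Pure states -/

section PureStates

variable {n : ℕ} {d : Fin n → ℕ}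

/-- The overlap `⟨φ|ρ|φ⟩`. -/
def overlap (φ : PureState d) (ρ : Op d) : ℂ := ∑ x, ∑ y, star (φ.1 x) * ρ x y * φ.1 y

theorem continuous_overlap (φ : PureState d) : Continuous (overlap φ) := by
  unfold overlap; fun_prop

theorem overlap_add (φ : PureState d) (ρ σ : Op d) :
    overlap φ (ρ + σ) = overlap φ ρ + overlap φ σ := by
  simp [overlap, mul_add, add_mul, Finset.sum_add_distrib]

theorem overlap_smul (φ : PureState d) (c : ℂ) (ρ : Op d) :
    overlap φ (c • ρ) = c * overlap φ ρ := by
  simp only [overlap, Finset.mul_sum, Matrix.smul_apply, smul_eq_mul]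
  exact Finset.sum_congr rfl fun x _ => Finset.sum_congr rfl fun y _ => by ring

theorem overlap_sum (φ : PureState d) {ι : Type*} (s : Finset ι) (ρ : ι → Op d) :
    overlap φ (∑ i ∈ s, ρ i) = ∑ i ∈ s, overlap φ (ρ i) := by
  classical
  induction s using Finset.induction with
  | empty => simp [overlap]
  | insert i s hi ih => rw [Finset.sum_insert hi, Finset.sum_insert hi, overlap_add, ih]

theorem dm_conjTranspose (ψ : PureState d) : ψ.dm.conjTranspose = ψ.dm := by
  ext x y; simp [PureState.dm, Matrix.conjTranspose_apply, mul_comm]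

theorem sum_star_mul_self (ψ : PureState d) : ∑ x, star (ψ.1 x) * ψ.1 x = 1 := by
  have h := EuclideanSpace.norm_sq_eq ψ.1
  rw [ψ.2] at h
  have h2 : ∀ x, star (ψ.1 x) * ψ.1 x = ((‖ψ.1 x‖ ^ 2 : ℝ) : ℂ) := fun x => by
    push_cast; exact Complex.conj_mul' _
  simp only [h2]
  rw [← Complex.ofReal_sum, ← h]; norm_num

theorem dm_mul_mul_dm (ψ : PureState d) (ρ : Op d) : ψ.dm * ρ * ψ.dm = overlap ψ ρ • ψ.dm := by
  ext x y
  simp only [Matrix.mul_apply, PureState.dm, Matrix.of_apply, Matrix.smul_apply, smul_eq_mul,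
    overlap, Finset.sum_mul]
  rw [Finset.sum_comm]
  exact Finset.sum_congr rfl fun i _ => Finset.sum_congr rfl fun j _ => by ring

theorem dm_mul_self (ψ : PureState d) : ψ.dm * ψ.dm = ψ.dm := by
  ext x y
  simp only [Matrix.mul_apply, PureState.dm, Matrix.of_apply]
  calc _ = (∑ z, star (ψ.1 z) * ψ.1 z) * (ψ.1 x * star (ψ.1 y)) := by
        rw [Finset.sum_mul]; exact Finset.sum_congr rfl fun i _ => by ring
    _ = _ := by rw [sum_star_mul_self, one_mul]

theorem trace_dm (ψ : PureState d) : ψ.dm.trace = 1 := by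
  rw [← sum_star_mul_self ψ]
  exact Finset.sum_congr rfl fun i _ => by simp [PureState.dm, mul_comm]

theorem overlap_dm (φ ψ : PureState d) :
    overlap φ ψ.dm = ((‖inner ℂ φ.1 ψ.1‖ ^ 2 : ℝ) : ℂ) := by
  push_cast
  rw [← Complex.mul_conj', PiLp.inner_apply, map_sum, Finset.sum_mul_sum]
  refine Finset.sum_congr rfl fun x _ => Finset.sum_congr rfl fun y _ => ?_
  simp [PureState.dm]; ring

theorem overlap_dm_self (φ : PureState d) : overlap φ φ.dm = 1 := by
  rw [overlap_dm, inner_self_eq_norm_sq_to_K, φ.2]; simp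

theorem overlap_dm_re (φ ψ : PureState d) :
    (overlap φ ψ.dm).re = ‖inner ℂ φ.1 ψ.1‖ ^ 2 := by
  rw [overlap_dm, Complex.ofReal_re]

theorem overlap_dm_comm (φ ψ : PureState d) : overlap φ ψ.dm = overlap ψ φ.dm := by
  rw [overlap_dm, overlap_dm, norm_inner_symm]

theorem overlap_dm_re_le_one (φ ψ : PureState d) : (overlap φ ψ.dm).re ≤ 1 := by
  rw [overlap_dm_re]
  have h := norm_inner_le_norm (𝕜 := ℂ) φ.1 ψ.1
  rw [φ.2, ψ.2, mul_one] at h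
  exact pow_le_one₀ (norm_nonneg _) h

/-- A rank-one projection is its own square root, and compressing by it leaves the overlap times the
projection. -/
theorem fidelity_dm (φ ψ : PureState d) : fidelity φ.dm ψ.dm = (overlap φ ψ.dm).re := by
  rw [fidelity, matSqrt_of_projection (dm_conjTranspose φ) (dm_mul_self φ), dm_mul_mul_dm,
    overlap_dm, matSqrt_smul_projection (dm_conjTranspose φ) (dm_mul_self φ) (norm_nonneg _),
    Matrix.trace_smul, trace_dm]
  simp only [smul_eq_mul, mul_one, Complex.ofReal_re]

theorem overlap_eq_trace (φ : PureState d) (ρ : Op d) : overlap φ ρ = (φ.dm * ρ).trace := by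
  simp only [overlap, Matrix.trace, Matrix.diag, Matrix.mul_apply, PureState.dm, Matrix.of_apply]
  rw [Finset.sum_comm]
  exact Finset.sum_congr rfl fun i _ => Finset.sum_congr rfl fun j _ => by ring

theorem hsSq_dm (ψ : PureState d) : hsSq ψ.dm = 1 := by
  have h := trace_conjTranspose_mul_self_eq_hsSq ψ.dm
  rw [dm_conjTranspose, dm_mul_self, trace_dm] at h
  exact_mod_cast h.symm

theorem hsSq_sub_dm {ρ : Op d} (hρ : ρ.conjTranspose = ρ) (φ : PureState d) :
    hsSq (ρ - φ.dm) = hsSq ρ - 2 * (overlap φ ρ).re + 1 := by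
  have h := trace_conjTranspose_mul_self_eq_hsSq (ρ - φ.dm)
  have h1 := trace_conjTranspose_mul_self_eq_hsSq ρ
  rw [Matrix.conjTranspose_sub, dm_conjTranspose, hρ, sub_mul, mul_sub, mul_sub, dm_mul_self,
    Matrix.trace_sub, Matrix.trace_sub, Matrix.trace_sub, Matrix.trace_mul_comm ρ φ.dm,
    ← overlap_eq_trace, trace_dm] at h
  rw [hρ] at h1
  rw [h1] at h
  have h2 := congrArg Complex.re h
  simp at h2
  linarith

end PureStates

/-! ### Product operators acting on operators and states -/

section ProductOperators

variable {n : ℕ} {d : Fin n → ℕ}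

/-- Tuples of local operators. -/
abbrev LocalTuple (d : Fin n → ℕ) : Type := ∀ i, Matrix (Fin (d i)) (Fin (d i)) ℂ

theorem prodOp_mul (A B : LocalTuple d) : prodOp (A * B) = prodOp A * prodOp B := by
  ext x y
  simp only [prodOp, Matrix.of_apply, Pi.mul_apply, Matrix.mul_apply, Finset.prod_univ_sum,
    Fintype.piFinset_univ, Finset.prod_mul_distrib]

theorem prodOp_one : prodOp (1 : LocalTuple d) = 1 := by
  ext x y
  simp only [prodOp, Matrix.of_apply, Pi.one_apply, Matrix.one_apply, Finset.prod_ite_zero,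
    Finset.prod_const_one, Finset.mem_univ, true_imp_iff, funext_iff]

theorem prodOp_conjTranspose (A : LocalTuple d) :
    (prodOp A).conjTranspose = prodOp fun i => (A i).conjTranspose := by
  ext x y
  simp [prodOp, Matrix.conjTranspose_apply]

/-- The map `X ↦ K X K†` with `K = A 1 ⊗ ⋯ ⊗ A n`, as a homomorphism in `A`. -/
noncomputable def prodConj : LocalTuple d →* Module.End ℂ (Op d) where
  toFun A := conjMap (prodOp A)
  map_one' := by
    ext X : 1
    simp [conjMap, prodOp_one]
  map_mul' A B := by
    refine LinearMap.ext fun X => ?_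
    simp [conjMap, prodOp_mul, Matrix.mul_assoc]

theorem prodConj_apply (A : LocalTuple d) (X : Op d) :
    prodConj A X = prodOp A * X * (prodOp A).conjTranspose := rfl

theorem trace_prodConj (A : LocalTuple d) (X : Op d) :
    (prodConj A X).trace = ((prodOp A).conjTranspose * prodOp A * X).trace := by
  rw [prodConj_apply, Matrix.trace_mul_cycle]

theorem continuous_superOp (E : SuperOp d) : Continuous E := by
  exact LinearMap.continuous_of_finiteDimensional E

/-- `E` is trace preserving. -/
def TracePreserving (E : SuperOp d) : Prop := ∀ X, (E X).trace = X.trace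

/-- Cyclicity and nondegeneracy of the trace pairing. Completeness of Kraus operators can thus be
carried as a property of the total map, which does not see how that map is decomposed. -/
theorem sum_prodConj_tracePreserving_iff {ι : Type*} [Fintype ι] (K : ι → LocalTuple d) :
    TracePreserving (∑ a, prodConj (K a) : Module.End ℂ (Op d)) ↔
      ∑ a, (prodOp (K a)).conjTranspose * prodOp (K a) = 1 := by
  have key : ∀ X : Op d, ((∑ a, prodConj (K a) : Module.End ℂ (Op d)) X).trace =
      ((∑ a, (prodOp (K a)).conjTranspose * prodOp (K a)) * X).trace := fun X => by
    rw [LinearMap.sum_apply, Matrix.trace_sum, Finset.sum_mul, Matrix.trace_sum]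
    exact Finset.sum_congr rfl fun a _ => trace_prodConj _ _
  constructor
  · intro h
    refine Matrix.ext_iff_trace_mul_right.2 fun X => ?_
    rw [← key, h, one_mul]
  · intro h X
    rw [key, h, one_mul]

/-- A product operator maps a pure state to a multiple of a pure state. -/
theorem exists_prodConj_dm (A : LocalTuple d) (ψ : PureState d) :
    ∃ (p : ℝ) (χ : PureState d), 0 ≤ p ∧ prodConj A ψ.dm = (p : ℂ) • χ.dm := by
  set v : EuclideanSpace ℂ (Idx d) := WithLp.toLp 2 fun x => ∑ y, prodOp A x y * ψ.1 y with hv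
  have hdm : ∀ x y, prodConj A ψ.dm x y = v x * star (v y) := by
    intro x y
    rw [prodConj_apply]
    simp only [Matrix.mul_apply, Matrix.conjTranspose_apply, PureState.dm, Matrix.of_apply, hv,
      star_sum, star_mul', Finset.sum_mul, Finset.mul_sum]
    exact Finset.sum_congr rfl fun i _ => Finset.sum_congr rfl fun j _ => by ring
  by_cases h0 : v = 0
  -- If the vector is annihilated, any state serves with weight zero.
  · refine ⟨0, ψ, le_rfl, ?_⟩
    ext x y
    rw [hdm, h0]; simp
  · have hn : ‖v‖ ≠ 0 := norm_ne_zero_iff.2 h0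
    refine ⟨‖v‖ ^ 2, ⟨((‖v‖⁻¹ : ℝ) : ℂ) • v, ?_⟩, by positivity, ?_⟩
    · rw [norm_smul]; simp [hn]
    · ext x y
      rw [hdm]
      simp only [Matrix.smul_apply, PureState.dm, Matrix.of_apply, PiLp.smul_apply, smul_eq_mul,
        star_mul']
      have : (‖v‖ : ℂ) ≠ 0 := by exact_mod_cast hn
      simp
      field_simp

/-- The tuple of local operators underlying a tuple of local unitaries. -/
abbrev unitaryTuple (U : ∀ i, Matrix.unitaryGroup (Fin (d i)) ℂ) : LocalTuple d :=
  fun i => (U i : Matrix (Fin (d i)) (Fin (d i)) ℂ)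

theorem prodOp_unitary (U : ∀ i, Matrix.unitaryGroup (Fin (d i)) ℂ) :
    (prodOp (unitaryTuple U)).conjTranspose * prodOp (unitaryTuple U) = 1 := by
  rw [prodOp_conjTranspose, ← prodOp_mul, ← prodOp_one]
  congr 1
  ext1 i
  exact Matrix.UnitaryGroup.star_mul_self (U i)

theorem exists_prodConj_unitary_dm (U : ∀ i, Matrix.unitaryGroup (Fin (d i)) ℂ)
    (ψ : PureState d) : ∃ χ : PureState d, prodConj (unitaryTuple U) ψ.dm = χ.dm := by
  obtain ⟨p, χ, -, h⟩ := exists_prodConj_dm (unitaryTuple U) ψ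
  have ht := trace_prodConj (unitaryTuple U) ψ.dm
  rw [prodOp_unitary, one_mul, trace_dm, h, Matrix.trace_smul, trace_dm, smul_eq_mul,
    mul_one] at ht
  exact ⟨χ, by rw [h, ht, one_smul]⟩

/-- Heisenberg picture: undoing U on the state amounts to rotating the target by U. -/
theorem overlap_prodConj_unitary (U : ∀ i, Matrix.unitaryGroup (Fin (d i)) ℂ)
    (ρ : Op d) {φ χ : PureState d} (hχ : prodConj (unitaryTuple U) φ.dm = χ.dm) :
    overlap φ (prodConj (unitaryTuple U⁻¹) ρ) = overlap χ ρ := by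
  have hinv : prodOp (unitaryTuple U⁻¹) = (prodOp (unitaryTuple U)).conjTranspose := by
    rw [prodOp_conjTranspose]; rfl
  rw [overlap_eq_trace, overlap_eq_trace, ← hχ, prodConj_apply, prodConj_apply, hinv,
    Matrix.conjTranspose_conjTranspose, ← Matrix.mul_assoc, ← Matrix.mul_assoc,
    Matrix.trace_mul_comm]
  simp only [Matrix.mul_assoc]

theorem fidelityLU_bddAbove (χ φ : PureState d) :
    BddAbove (Set.range fun U : ∀ i, Matrix.unitaryGroup (Fin (d i)) ℂ =>
      fidelity χ.dm (conjMap (prodOp fun i => (U i : Matrix (Fin (d i)) (Fin (d i)) ℂ)) φ.dm)) := by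
  refine ⟨1, ?_⟩
  rintro _ ⟨U, rfl⟩
  obtain ⟨η, hη⟩ := exists_prodConj_unitary_dm U φ
  change fidelity χ.dm (prodConj (unitaryTuple U) φ.dm) ≤ 1
  rw [hη, fidelity_dm]
  exact overlap_dm_re_le_one _ _

theorem overlap_le_fidelityLU (χ φ : PureState d) :
    (overlap χ φ.dm).re ≤ fidelityLU χ.dm φ.dm := by
  refine le_ciSup_of_le (fidelityLU_bddAbove χ φ) 1 ?_
  change _ ≤ fidelity χ.dm (prodConj (1 : LocalTuple d) φ.dm)
  rw [map_one, Module.End.one_apply, fidelity_dm]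

/-- Near-optimal unitaries suffice throughout, so attainment of the supremum is never needed. -/
theorem exists_unitary_fidelityLU_lt (χ φ : PureState d) {r : ℝ} (hr : r < fidelityLU χ.dm φ.dm) :
    ∃ (U : ∀ i, Matrix.unitaryGroup (Fin (d i)) ℂ) (η : PureState d),
      prodConj (unitaryTuple U) φ.dm = η.dm ∧ r < (overlap χ η.dm).re := by
  obtain ⟨U, hU⟩ := exists_lt_of_lt_ciSup hr
  obtain ⟨η, hη⟩ := exists_prodConj_unitary_dm U φ
  refine ⟨U, η, hη, ?_⟩
  change r < fidelity χ.dm (prodConj (unitaryTuple U) φ.dm) at hU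
  rwa [hη, fidelity_dm] at hU

end ProductOperators

/-! ### Finite-round protocols -/

section Coarse

variable {n : ℕ} {d : Fin n → ℕ}

theorem coarse_id {O : Type} [Fintype O] (J : O → SuperOp d) : coarse J id = J := by
  classical
  ext1 c
  simp [coarse, Finset.sum_filter]

theorem coarse_coarse {O M N : Type} [Fintype O] [Fintype M] (J : O → SuperOp d) (f : O → M)
    (g : M → N) : coarse (coarse J f) g = coarse J (g ∘ f) := by
  classical
  ext1 c
  simp only [coarse, Finset.sum_filter, Function.comp_apply]
  calc _ = ∑ m, ∑ o, if f o = m then (if g m = c then J o else 0) else 0 := by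
        refine Finset.sum_congr rfl fun m _ => ?_
        split_ifs <;> simp
    _ = _ := by
        rw [Finset.sum_comm]
        simp

theorem sum_coarse {O M : Type} [Fintype O] [Fintype M] (J : O → SuperOp d) (f : O → M) :
    ∑ c, coarse J f c = ∑ o, J o := by
  classical
  exact Finset.sum_fiberwise _ _ _

theorem coarse_unit {O : Type} [Fintype O] (J : O → SuperOp d) (f : O → Unit) :
    coarse J f = fun _ => ∑ o, J o := by
  classical
  ext1 c
  simp [coarse]

theorem coarse_mul {O M : Type} [Fintype O] (J : O → Module.End ℂ (Op d)) (g : O → M)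
    (A : Module.End ℂ (Op d)) (c : M) :
    coarse (fun o => J o * A) g c = (coarse J g c : Module.End ℂ (Op d)) * A := by
  classical
  exact (Finset.sum_mul ..).symm

theorem coarse_sigma_fst {O : Type} [Fintype O] {T : O → Type} [∀ o, Fintype (T o)]
    (F : (Σ o, T o) → SuperOp d) (o : O) : coarse F Sigma.fst o = ∑ t, F ⟨o, t⟩ := by
  classical
  simp only [coarse, Finset.sum_filter, Fintype.sum_sigma]
  rw [Finset.sum_eq_single o (fun o' _ h => by simp [h]) (by simp)]
  simp

theorem coarse_sigma_map {O : Type} [Fintype O] {P : O → Type} [∀ o, Fintype (P o)]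
    {T : ∀ o, P o → Type} [∀ o x, Fintype (T o x)]
    (F : (Σ o, Σ x, T o x) → SuperOp d) (o : O) (x : P o) :
    coarse F (fun y => (⟨y.1, y.2.1⟩ : Σ o, P o)) ⟨o, x⟩ = ∑ t, F ⟨o, x, t⟩ := by
  classical
  simp only [coarse, Finset.sum_filter, Fintype.sum_sigma]
  rw [Finset.sum_eq_single o (fun o' _ h => by simp [h]) (by simp),
    Finset.sum_eq_single x (fun o' _ h => by simp [h]) (by simp)]
  simp

end Coarse

/-! ### Finite-round protocols as a class, and their relation to LOCC. -/

section Protocols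

variable {n : ℕ} {d : Fin n → ℕ}

/-- A finite family of maps, regarded as the instrument implemented by a protocol. -/
structure Protocol (d : Fin n → ℕ) : Type 1 where
  /-- The outcomes. -/
  O : Type
  [fintype : Fintype O]
  /-- The map implemented for each outcome. -/
  J : O → SuperOp d

attribute [instance] Protocol.fintype

/-- The protocol does nothing. -/
def Protocol.IsStart (P : Protocol d) : Prop :=
  ∃ o₀ : P.O, (∀ o, o = o₀) ∧ P.J o₀ = LinearMap.id

/-- `Q` arises from `P` by one further round. -/
def Protocol.Step (P Q : Protocol d) : Prop := Linked P.J Q.J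

/-- Protocols obtained from the one that does nothing by finitely many rounds. -/
inductive FiniteRound : Protocol d → Prop
  | start {P : Protocol d} : P.IsStart → FiniteRound P
  | round {P Q : Protocol d} : FiniteRound P → P.Step Q → FiniteRound Q

/-- A round in which every party applies a single Kraus operator for each announced outcome. -/
def prodRound {T : Type} [Fintype T] (i : Fin n) (K : T → LocalTuple d)
    (hi : ∑ t, (K t i).conjTranspose * K t i = 1)
    (hj : ∀ t j, j ≠ i → (K t j).conjTranspose * K t j = 1) : Round d T where
  party := i
  rank _ _ := 1
  kraus t j _ := K t j
  measurement := by simpa using hi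
  channel t j h := by simpa using hj t j h

theorem prodRound_op {T : Type} [Fintype T] (i : Fin n) (K : T → LocalTuple d)
    (hi : ∑ t, (K t i).conjTranspose * K t i = 1)
    (hj : ∀ t j, j ≠ i → (K t j).conjTranspose * K t j = 1) (t : T) :
    (prodRound i K hi hj).op t = prodConj (K t) := by
  change ∑ a : Fin n → Fin 1, prodConj (K t) = prodConj (K t)
  simp

/-- One more round of local unitaries, chosen depending on the outcome. -/
theorem linked_unitary (i₀ : Fin n) {O O' : Type} [Fintype O] (J : O → Module.End ℂ (Op d))
    (U : O → ∀ i, Matrix.unitaryGroup (Fin (d i)) ℂ) (f : O → O') :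
    Linked J (coarse (fun o => prodConj (unitaryTuple (U o)) * J o) f) := by
  classical
  have h1 : ∀ o i, (unitaryTuple (U o) i).conjTranspose * unitaryTuple (U o) i = 1 :=
    fun o i => Matrix.UnitaryGroup.star_mul_self (U o i)
  refine ⟨fun _ => Unit, fun _ => inferInstance,
    fun o => prodRound i₀ (fun _ => unitaryTuple (U o)) (by simp [h1]) (fun _ j _ => h1 o j),
    fun x => f x.1, ?_⟩
  ext1 c
  simp only [coarse, Finset.sum_filter, Fintype.sum_sigma, prodRound_op]
  simp
  rfl

/-- An idle round, used for padding. A round must name an acting party, whence `i₀`. -/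
theorem linked_self (i₀ : Fin n) {O : Type} [Fintype O] (J : O → SuperOp d) : Linked J J := by
  have h := linked_unitary i₀ J (fun _ => 1) id
  rw [coarse_id] at h
  have h1 : prodConj (unitaryTuple (1 : ∀ i, Matrix.unitaryGroup (Fin (d i)) ℂ)) = 1 :=
    map_one prodConj
  simpa only [Pi.one_apply, h1, one_mul] using h

theorem linked_mul_right {O O' : Type} [Fintype O] {J : O → Module.End ℂ (Op d)}
    {J' : O' → Module.End ℂ (Op d)} (h : Linked J J') (A : Module.End ℂ (Op d)) :
    Linked (fun o => J o * A) (fun o => J' o * A) := by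
  obtain ⟨P, hP, R, f, rfl⟩ := h
  refine ⟨P, hP, R, f, ?_⟩
  ext1 c
  exact (coarse_mul _ f A c).symm

/-- The unitary becomes the first round, performed when the protocol so far is still the identity;
later rounds depend only on outcomes and are unaffected by precomposition. -/
theorem FiniteRound.prepend_unitary (i₀ : Fin n) {P : Protocol d} (hP : FiniteRound P)
    (U : ∀ i, Matrix.unitaryGroup (Fin (d i)) ℂ) :
    FiniteRound ⟨P.O, fun o => (P.J o : Module.End ℂ (Op d)) * prodConj (unitaryTuple U)⟩ := by
  induction hP with
  | @start P h =>
    refine FiniteRound.round (FiniteRound.start h) ?_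
    obtain ⟨o₀, ho, hJ⟩ := h
    have hl := linked_unitary i₀ P.J (fun _ => U) id
    rw [coarse_id] at hl
    change Linked _ _
    convert hl using 2 with o
    change (P.J o : Module.End ℂ (Op d)) * _ = _ * (P.J o : Module.End ℂ (Op d))
    rw [ho o, hJ]; rfl
  | round _ h ih => exact FiniteRound.round ih (linked_mul_right h _)

theorem FiniteRound.exists_seq (i₀ : Fin n) {P : Protocol d} (hP : FiniteRound P) :
    ∃ s : ℕ → Protocol d, (s 0).IsStart ∧ (∀ ν, (s ν).Step (s (ν + 1))) ∧
      ∃ N, ∀ ν, N ≤ ν → s ν = P := by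
  induction hP with
  | @start P h => exact ⟨fun _ => P, h, fun _ => linked_self i₀ _, 0, fun _ _ => rfl⟩
  | @round P Q _ h ih =>
    obtain ⟨s, h0, hs, N, hN⟩ := ih
    -- At index N the old sequence has already reached P, so the switch to Q is exactly the given
    -- round; afterwards only idle rounds follow.
    refine ⟨fun ν => if ν ≤ N then s ν else Q, by simpa using h0, fun ν => ?_, N + 1, fun ν hν => ?_⟩
    · dsimp only
      rcases lt_trichotomy ν N with h1 | rfl | h1
      · rw [if_pos h1.le, if_pos (Nat.succ_le_of_lt h1)]; exact hs ν
      · rw [if_pos le_rfl, if_neg (by omega), hN ν le_rfl]; exact h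
      · rw [if_neg (by omega), if_neg (by omega)]; exact linked_self i₀ Q.J
    · exact if_neg (by omega)

theorem diamondNorm_zero {a b : Type} [Fintype a] [DecidableEq a] [Fintype b] [DecidableEq b] :
    diamondNorm (0 : Matrix a a ℂ →ₗ[ℂ] Matrix b b ℂ) = 0 := by
  have h : ∀ (k : ℕ) (X : Matrix (a × Fin k) (a × Fin k) ℂ),
      ampl k (0 : Matrix a a ℂ →ₗ[ℂ] Matrix b b ℂ) X = 0 := fun k X => by
    ext x y; simp [ampl]
  simp [diamondNorm, h, traceNorm_zero]

theorem FiniteRound.isLOCC (i₀ : Fin n) {P : Protocol d} (hP : FiniteRound P) {M : Type}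
    [Fintype M] [DecidableEq M] [Nonempty M] (g : P.O → M) : IsLOCC (coarse P.J g) := by
  obtain ⟨s, h0, hs, N, hN⟩ := hP.exists_seq i₀
  -- Before N the outcome type may differ from that of P, so the labelling there is an arbitrary
  -- constant; it does not affect the limit.
  have hg : ∀ ν, ∃ g' : (s ν).O → M, N ≤ ν → coarse (s ν).J g' = coarse P.J g := by
    intro ν
    by_cases h : N ≤ ν
    · rw [hN ν h]; exact ⟨g, fun _ => rfl⟩
    · exact ⟨fun _ => Classical.arbitrary M, fun h' => absurd h' h⟩
  choose g' hg' using hg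
  refine ⟨fun ν => (s ν).O, fun ν => (s ν).fintype, fun ν => (s ν).J, g', h0, hs, ?_⟩
  refine tendsto_const_nhds.congr' ?_
  filter_upwards [eventually_ge_atTop N] with ν hν
  rw [hg' ν hν, sub_self, diamondNorm_zero]

theorem exists_finiteRound_of_isLOCC {M : Type} [Fintype M] [DecidableEq M] {Λ : M → SuperOp d}
    (h : IsLOCC Λ) : ∃ (s : ℕ → Protocol d) (g : ∀ ν, (s ν).O → M), (∀ ν, FiniteRound (s ν)) ∧
      Tendsto (fun ν => diamondNorm (record (coarse (s ν).J (g ν)) - record Λ)) atTop (𝓝 0) := by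
  obtain ⟨O, hO, J, g, h0, hl, ht⟩ := h
  refine ⟨fun ν => ⟨O ν, J ν⟩, g, fun ν => ?_, ht⟩
  induction ν with
  | zero => exact FiniteRound.start h0
  | succ ν ih => exact FiniteRound.round ih (hl ν)

/-- Even the first link requires a round, and a round has an acting party; so nothing is LOCC when n
= 0. -/
theorem exists_party_of_isLOCC {M : Type} [Fintype M] [DecidableEq M] {Λ : M → SuperOp d}
    (h : IsLOCC Λ) : Nonempty (Fin n) := by
  obtain ⟨O, hO, J, g, ⟨o₀, -⟩, hl, ht⟩ := h
  obtain ⟨P, hP, R, -⟩ := hl 0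
  exact ⟨(R o₀).party⟩

/-- Convergence in diamond norm implies pointwise convergence on pure states. -/
theorem tendsto_apply_of_diamondNorm {M : Type} [Fintype M] [DecidableEq M]
    {Λs : ℕ → M → SuperOp d} {Λ : M → SuperOp d}
    (h : Tendsto (fun ν => diamondNorm (record (Λs ν) - record Λ)) atTop (𝓝 0))
    (ψ : PureState d) (c : M) : Tendsto (fun ν => Λs ν c ψ.dm) atTop (𝓝 (Λ c ψ.dm)) := by
  -- A trivial one-dimensional ancilla suffices to bound the action on ψ by the diamond norm.
  set X : Matrix (Idx d × Fin 1) (Idx d × Fin 1) ℂ := Matrix.of fun x y => ψ.dm x.1 y.1 with hX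
  have hX1 : traceNorm X ≤ 1 := by
    rw [traceNorm_of_projection]
    · have h1 : X.trace = ψ.dm.trace := by
        simp [Matrix.trace, Fintype.sum_prod_type, hX]
      rw [h1, trace_dm]; simp
    · ext x y
      have h1 := congrFun (congrFun (dm_conjTranspose ψ) x.1) y.1
      simpa [hX, Matrix.conjTranspose_apply] using h1
    · ext x y
      have h1 := congrFun (congrFun (dm_mul_self ψ) x.1) y.1
      simpa [hX, Matrix.mul_apply, Fintype.sum_prod_type] using h1
  have hb : ∀ ν x y, ENNReal.ofReal ‖(Λs ν c ψ.dm - Λ c ψ.dm) x y‖ ≤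
      diamondNorm (record (Λs ν) - record Λ) := by
    intro ν x y
    have h1 := norm_apply_le_traceNorm (ampl 1 (record (Λs ν) - record Λ) X) ((x, c), 0) ((y, c), 0)
    have h2 : ampl 1 (record (Λs ν) - record Λ) X ((x, c), 0) ((y, c), 0) =
        (Λs ν c ψ.dm - Λ c ψ.dm) x y := by
      simp [ampl, record, hX]
      rfl
    rw [h2] at h1
    exact (ENNReal.ofReal_le_ofReal h1).trans
      (le_iSup_of_le 1 (le_iSup_of_le X (le_iSup_of_le hX1 le_rfl)))
  refine tendsto_pi_nhds.2 fun x => tendsto_pi_nhds.2 fun y => ?_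
  rw [tendsto_iff_norm_sub_tendsto_zero]
  have h1 : Tendsto (fun ν => ENNReal.ofReal ‖(Λs ν c ψ.dm - Λ c ψ.dm) x y‖) atTop (𝓝 0) :=
    tendsto_of_tendsto_of_tendsto_of_le_of_le tendsto_const_nhds h (fun _ => bot_le)
      fun ν => hb ν x y
  have h2 := (ENNReal.tendsto_toReal ENNReal.zero_ne_top).comp h1
  refine (h2.congr fun ν => ?_)
  simp [Function.comp]

end Protocols

/-! ### Refining protocols until every outcome has a single product Kraus operator -/

section Refinement

variable {n : ℕ} {d : Fin n → ℕ}

/-- `J` is a coarse-graining of a finite-round protocol each of whose outcomes has a single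
Kraus operator, which is a product operator. -/
def Refinable {O : Type} [Fintype O] (J : O → SuperOp d) : Prop :=
  ∃ (O' : Type) (_ : Fintype O') (K : O' → LocalTuple d) (h : O' → O),
    FiniteRound ⟨O', fun o => prodConj (K o)⟩ ∧ J = coarse (fun o => prodConj (K o)) h

theorem Refinable.coarse {O M : Type} [Fintype O] [Fintype M] {J : O → SuperOp d}
    (hJ : Refinable J) (f : O → M) : Refinable (LocalOps.coarse J f) := by
  obtain ⟨O', hO', K, h, hK, rfl⟩ := hJ
  exact ⟨O', hO', K, f ∘ h, hK, coarse_coarse _ _ _⟩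

theorem mulSingle_conjTranspose_mul_self (i j : Fin n) (A : Matrix (Fin (d i)) (Fin (d i)) ℂ)
    (h : j ≠ i) : ((Pi.mulSingle i A : LocalTuple d) j).conjTranspose *
      (Pi.mulSingle i A : LocalTuple d) j = 1 := by
  rw [Pi.mulSingle_eq_of_ne h]; simp

/-- One more local measurement, all of whose Kraus operators are announced. -/
theorem Refinable.local_measurement {O : Type} [Fintype O] {J : O → Module.End ℂ (Op d)}
    (hJ : Refinable J) (i : O → Fin n) {T : O → Type} [∀ o, Fintype (T o)]
    (L : ∀ o, T o → Matrix (Fin (d (i o))) (Fin (d (i o))) ℂ)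
    (hL : ∀ o, ∑ t, (L o t).conjTranspose * L o t = 1) :
    Refinable (fun y : Σ o, T o => prodConj (Pi.mulSingle (i y.1) (L y.1 y.2)) * J y.1) := by
  classical
  obtain ⟨O', hO', K, h, hK, rfl⟩ := hJ
  refine ⟨Σ o', T (h o'), inferInstance,
    fun y => Pi.mulSingle (i (h y.1)) (L (h y.1) y.2) * K y.1, fun y => ⟨h y.1, y.2⟩, ?_, ?_⟩
  · refine FiniteRound.round hK ⟨fun o' => T (h o'), fun _ => inferInstance, fun o' =>
      prodRound (i (h o')) (fun t => Pi.mulSingle (i (h o')) (L (h o') t)) ?_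
        (fun t j hj => mulSingle_conjTranspose_mul_self _ _ _ hj), id, ?_⟩
    · simpa using hL (h o')
    · rw [coarse_id]
      ext1 y
      rw [prodRound_op]
      exact map_mul prodConj _ _
  · ext1 ⟨o, t⟩
    simp only [LocalOps.coarse, Finset.sum_filter, Fintype.sum_sigma, Finset.mul_sum]
    refine Finset.sum_congr rfl fun o' _ => ?_
    by_cases ho : h o' = o
    · subst ho
      simp
    · simp [ho]

/-- `Φ` is a channel of party `i`. -/
def IsLocalChannel (i : Fin n) (Φ : Module.End ℂ (Op d)) : Prop :=
  ∃ (r : ℕ) (L : Fin r → Matrix (Fin (d i)) (Fin (d i)) ℂ),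
    ∑ a, (L a).conjTranspose * L a = 1 ∧ Φ = ∑ a, prodConj (Pi.mulSingle i (L a))

theorem isLocalChannel_one (i : Fin n) : IsLocalChannel (d := d) i 1 :=
  ⟨1, fun _ => 1, by simp, by simp⟩

/-- A channel is a measurement of its Kraus index followed by forgetting the result. -/
theorem Refinable.local_channel {O : Type} [Fintype O] {J : O → Module.End ℂ (Op d)}
    (hJ : Refinable J) (i : Fin n) {Φ : O → Module.End ℂ (Op d)}
    (hΦ : ∀ o, IsLocalChannel i (Φ o)) : Refinable (fun o => Φ o * J o) := by
  choose r L hL hΦ using hΦ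
  convert (hJ.local_measurement (fun _ => i) L hL).coarse Sigma.fst using 1
  ext1 o
  rw [coarse_sigma_fst, hΦ, Finset.sum_mul]

theorem sum_pi_insert {ι M : Type*} [DecidableEq ι] [AddCommMonoid M] {κ : ι → Type*}
    {s : Finset ι} {j : ι} (hj : j ∉ s) (t : ∀ i, Finset (κ i))
    (f : (∀ i ∈ insert j s, κ i) → M) :
    ∑ a ∈ (insert j s).pi t, f a = ∑ b ∈ t j, ∑ a ∈ s.pi t, f (Finset.Pi.cons s j b a) := by
  classical
  rw [Finset.pi_insert hj, Finset.sum_biUnion]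
  · exact Finset.sum_congr rfl fun b _ =>
      Finset.sum_image fun p _ q _ h => Finset.Pi.cons_injective hj h
  · intro x _ y _ h
    simp only [Function.onFun, Finset.disjoint_iff_ne, Finset.mem_image]
    rintro _ ⟨p, _, hp⟩ _ ⟨q, _, hq⟩ hpq
    have : Finset.Pi.cons s j x p j (Finset.mem_insert_self _ _) =
        Finset.Pi.cons s j y q j (Finset.mem_insert_self _ _) := by rw [hp, hq, hpq]
    rw [Finset.Pi.cons_same, Finset.Pi.cons_same] at this
    exact h this

/-- The channels of the parties in `s`. -/
noncomputable def partialOp {r : Fin n → ℕ}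
    (k : ∀ i, Fin (r i) → Matrix (Fin (d i)) (Fin (d i)) ℂ) (s : Finset (Fin n)) :
    Module.End ℂ (Op d) :=
  ∑ a ∈ s.pi fun _ => Finset.univ, prodConj fun i => if h : i ∈ s then k i (a i h) else 1

theorem partialOp_empty {r : Fin n → ℕ}
    (k : ∀ i, Fin (r i) → Matrix (Fin (d i)) (Fin (d i)) ℂ) : partialOp k ∅ = 1 := by
  simp only [partialOp, Finset.pi_empty, Finset.sum_singleton]
  exact map_one prodConj

theorem partialOp_insert {r : Fin n → ℕ}
    (k : ∀ i, Fin (r i) → Matrix (Fin (d i)) (Fin (d i)) ℂ) {s : Finset (Fin n)} {j : Fin n}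
    (hj : j ∉ s) :
    partialOp k (insert j s) = (∑ b, prodConj (Pi.mulSingle j (k j b))) * partialOp k s := by
  rw [partialOp, sum_pi_insert hj, Finset.sum_mul]
  refine Finset.sum_congr rfl fun b _ => ?_
  rw [partialOp, Finset.mul_sum]
  refine Finset.sum_congr rfl fun a _ => ?_
  rw [← map_mul]
  congr 1
  ext1 i
  by_cases hi : i = j
  · subst hi
    simp [hj]
  · rw [Pi.mul_apply, Pi.mulSingle_eq_of_ne hi, one_mul]
    by_cases his : i ∈ s
    · rw [dif_pos his, dif_pos (Finset.mem_insert_of_mem his), Finset.Pi.cons_ne (Ne.symm hi)]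
    · rw [dif_neg his, dif_neg (by simp [hi, his])]

theorem partialOp_univ {O : Type} [Fintype O] (R : Round d O) (o : O) :
    partialOp (R.kraus o) Finset.univ = R.op o := by
  rw [partialOp, Finset.sum_univ_pi]
  simp only [Finset.mem_univ, dif_pos, Fintype.piFinset_univ]
  rfl

/-- A round is split into the measurement, with its Kraus indices announced too, followed by the
other parties' channels one party at a time. Each piece is a local measurement with one Kraus
operator per outcome, and coarse-graining recovers the round. -/
theorem Refinable.linked {O O' : Type} [Fintype O] [Fintype O'] {J : O → SuperOp d}
    {J' : O' → SuperOp d} (hJ : Refinable J) (h : Linked J J') : Refinable J' := by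
  classical
  obtain ⟨P, hP, R, f, rfl⟩ := h
  refine Refinable.coarse ?_ f
  -- The measuring party is always included: its maps are complete only after summing over announced
  -- outcomes, so they must come first, while the other channels can be added in any order.
  have key : ∀ s : Finset (Fin n), Refinable (fun y : Σ o, P o =>
      partialOp ((R y.1).kraus y.2) (insert (R y.1).party s) * (J y.1 : Module.End ℂ (Op d))) := by
    intro s
    induction s using Finset.induction with
    | empty =>
      have h1 := hJ.local_measurement (fun o => (R o).party)
        (T := fun o => Σ x : P o, Fin ((R o).rank x (R o).party))
        (fun o t => (R o).kraus t.1 (R o).party t.2)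
        (fun o => by rw [Fintype.sum_sigma]; exact (R o).measurement)
      convert h1.coarse (fun y => (⟨y.1, y.2.1⟩ : Σ o, P o)) using 1
      ext1 ⟨o, x⟩
      rw [coarse_sigma_map, partialOp_insert _ (Finset.notMem_empty _), partialOp_empty, mul_one,
        Finset.sum_mul]
    | insert j s hj ih =>
      have h1 := ih.local_channel j (Φ := fun y => if j = (R y.1).party then 1 else
        ∑ a, prodConj (Pi.mulSingle j ((R y.1).kraus y.2 j a))) (fun y => by
          split_ifs with h
          · exact isLocalChannel_one j
          · exact ⟨_, _, (R y.1).channel y.2 j h, rfl⟩)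
      convert h1 using 1
      ext1 y
      split_ifs with h
      · rw [one_mul, ← h, Finset.insert_idem]
      · rw [Finset.insert_comm, partialOp_insert _ (by simp [h, hj]), mul_assoc]
  convert key Finset.univ using 1
  ext1 y
  rw [Finset.insert_eq_of_mem (Finset.mem_univ _), partialOp_univ]
  rfl

theorem FiniteRound.refinable {P : Protocol d} (hP : FiniteRound P) : Refinable P.J := by
  induction hP with
  | @start P h =>
    have hJ : (fun _ : P.O => prodConj (1 : LocalTuple d)) = P.J := by
      obtain ⟨o₀, ho, hJ⟩ := h
      ext1 o
      rw [ho o, hJ, map_one]; rfl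
    refine ⟨P.O, P.fintype, fun _ => 1, id, ?_, ?_⟩
    · rw [hJ]; exact FiniteRound.start h
    · rw [coarse_id, hJ]
  | round _ h ih => exact ih.linked h

end Refinement

/-! ### Finite-round protocols preserve the trace and are separable -/

section Separable

variable {n : ℕ} {d : Fin n → ℕ}

theorem sum_prodOp_conjTranspose_mul_self {r : Fin n → ℕ}
    (k : ∀ i, Fin (r i) → Matrix (Fin (d i)) (Fin (d i)) ℂ) :
    ∑ a : ∀ i, Fin (r i), (prodOp fun i => k i (a i)).conjTranspose * (prodOp fun i => k i (a i)) =
      prodOp fun i => ∑ b, (k i b).conjTranspose * k i b := by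
  have h : ∀ a : ∀ i, Fin (r i),
      (prodOp fun i => k i (a i)).conjTranspose * (prodOp fun i => k i (a i)) =
        prodOp fun i => (k i (a i)).conjTranspose * k i (a i) := fun a => by
    rw [prodOp_conjTranspose, ← prodOp_mul]; rfl
  simp only [h]
  ext x y
  simp only [Matrix.sum_apply, prodOp, Matrix.of_apply, Finset.prod_univ_sum,
    Fintype.piFinset_univ]

theorem prodOp_mulSingle_apply (i : Fin n) (A : Matrix (Fin (d i)) (Fin (d i)) ℂ) (x y : Idx d) :
    prodOp (Pi.mulSingle i A) x y = A (x i) (y i) *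
      ∏ j ∈ Finset.univ.erase i, (1 : LocalTuple d) j (x j) (y j) := by
  rw [prodOp, Matrix.of_apply, ← Finset.mul_prod_erase _ _ (Finset.mem_univ i),
    Pi.mulSingle_eq_same]
  congr 1
  refine Finset.prod_congr rfl fun j hj => ?_
  rw [Pi.mulSingle_eq_of_ne (Finset.ne_of_mem_erase hj)]; rfl

theorem sum_prodOp_mulSingle {ι : Type*} [Fintype ι] (i : Fin n)
    (M : ι → Matrix (Fin (d i)) (Fin (d i)) ℂ) :
    ∑ t, prodOp (Pi.mulSingle i (M t)) = prodOp (d := d) (Pi.mulSingle i (∑ t, M t)) := by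
  ext x y
  simp only [Matrix.sum_apply, prodOp_mulSingle_apply, Finset.sum_mul]

/-- For a fixed outcome the Kraus sum is a product operator equal to the identity off the measuring
party; the sum over outcomes is then linear in the one remaining factor. -/
theorem sum_round_op_tracePreserving {O : Type} [Fintype O] (R : Round d O) :
    TracePreserving (∑ o, R.op o) := by
  have h : ∑ o, R.op o = (∑ x : Σ o, ∀ i, Fin (R.rank o i),
      prodConj (fun i => R.kraus x.1 i (x.2 i)) : Module.End ℂ (Op d)) := by
    rw [Fintype.sum_sigma]; rfl
  rw [h, sum_prodConj_tracePreserving_iff, Fintype.sum_sigma]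
  simp only [sum_prodOp_conjTranspose_mul_self]
  have h2 : ∀ o, (fun i => ∑ b, (R.kraus o i b).conjTranspose * R.kraus o i b) =
      (Pi.mulSingle R.party (∑ b, (R.kraus o R.party b).conjTranspose * R.kraus o R.party b) :
        LocalTuple d) := fun o => by
    ext1 i
    by_cases hi : i = R.party
    · subst hi; rw [Pi.mulSingle_eq_same]
    · rw [Pi.mulSingle_eq_of_ne hi, R.channel o i hi]
  simp only [h2]
  rw [sum_prodOp_mulSingle, R.measurement, Pi.mulSingle_one, prodOp_one]

theorem FiniteRound.tracePreserving {P : Protocol d} (hP : FiniteRound P) :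
    TracePreserving (∑ o, P.J o) := by
  induction hP with
  | @start P h =>
    obtain ⟨o₀, ho, hJ⟩ := h
    rw [Finset.sum_eq_single o₀ (fun o _ h => absurd (ho o) h) (by simp), hJ]
    exact fun _ => rfl
  | @round P Q _ h ih =>
    obtain ⟨T, hT, R, f, hf⟩ := h
    intro X
    rw [hf, sum_coarse, Fintype.sum_sigma, LinearMap.sum_apply, Matrix.trace_sum, ← ih X,
      LinearMap.sum_apply, Matrix.trace_sum]
    refine Finset.sum_congr rfl fun o _ => ?_
    rw [← sum_round_op_tracePreserving (R o) (P.J o X)]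
    simp [LinearMap.sum_apply]

theorem isSEP_of_tracePreserving {ι : Type*} [Fintype ι] {K : ι → LocalTuple d}
    (h : TracePreserving (∑ a, prodConj (K a) : Module.End ℂ (Op d))) :
    IsSEP (∑ a, prodConj (K a) : Module.End ℂ (Op d)) := by
  have e := (Fintype.equivFin ι).symm
  rw [← Equiv.sum_comp e] at h ⊢
  exact ⟨_, fun a => K (e a), (sum_prodConj_tracePreserving_iff _).1 h, rfl⟩

theorem FiniteRound.isSEP {P : Protocol d} (hP : FiniteRound P) : IsSEP (∑ o, P.J o) := by
  have htp := hP.tracePreserving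
  obtain ⟨O', hO', K, h, -, hJ⟩ := hP.refinable
  rw [hJ, sum_coarse] at htp ⊢
  exact isSEP_of_tracePreserving htp

end Separable

/-! ### The outputs of separable maps form a closed set -/

section SeparableClosed

variable {n : ℕ} {d : Fin n → ℕ}

theorem isCompact_hsSq_eq_one {a : Type} [Fintype a] :
    IsCompact {A : Matrix a a ℂ | hsSq A = 1} := by
  have hc : IsCompact (Set.univ.pi fun _ : a => Set.univ.pi fun _ : a =>
      Metric.closedBall (0 : ℂ) 1) :=
    isCompact_univ_pi fun _ => isCompact_univ_pi fun _ => isCompact_closedBall 0 1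
  refine IsCompact.of_isClosed_subset hc (isClosed_eq continuous_hsSq continuous_const) ?_
  intro A hA x _ y _
  rw [mem_closedBall_zero_iff]
  have h := norm_apply_le_sqrt_hsSq A x y
  rwa [show hsSq A = 1 from hA, Real.sqrt_one] at h

theorem hsSq_smul {a : Type} [Fintype a] (c : ℂ) (A : Matrix a a ℂ) :
    hsSq (c • A) = ‖c‖ ^ 2 * hsSq A := by
  simp [hsSq, Finset.mul_sum, mul_pow]

theorem exists_smul_hsSq_eq_one {a : Type} [Fintype a] [Nonempty a] (A : Matrix a a ℂ) :
    ∃ (t : ℝ) (B : Matrix a a ℂ), hsSq B = 1 ∧ A = (t : ℂ) • B := by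
  classical
  by_cases h : hsSq A = 0
  · obtain ⟨z⟩ := ‹Nonempty a›
    -- The zero matrix gets weight zero and an arbitrary unit direction.
    refine ⟨0, Matrix.single z z 1, ?_, ?_⟩
    · rw [hsSq, Finset.sum_eq_single z, Finset.sum_eq_single z]
      · simp
      · intro y _ hy; simp [hy.symm]
      · simp
      · intro x _ hx; simp [hx.symm]
      · simp
    · ext x y
      have h1 := norm_apply_le_sqrt_hsSq A x y
      rw [h, Real.sqrt_zero] at h1
      simpa using h1
  · have h0 : 0 < hsSq A := lt_of_le_of_ne (hsSq_nonneg A) (Ne.symm h)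
    refine ⟨√(hsSq A), ((√(hsSq A))⁻¹ : ℂ) • A, ?_, ?_⟩
    · rw [hsSq_smul, norm_inv, Complex.norm_real, Real.norm_of_nonneg (Real.sqrt_nonneg _),
        inv_pow, Real.sq_sqrt h0.le, inv_mul_cancel₀ h]
    · rw [smul_smul, mul_inv_cancel₀, one_smul]
      exact_mod_cast (Real.sqrt_pos.2 h0).ne'

theorem trace_prodOp (A : LocalTuple d) : (prodOp A).trace = ∏ i, (A i).trace := by
  simp only [Matrix.trace, Matrix.diag, prodOp, Matrix.of_apply, Finset.prod_univ_sum,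
    Fintype.piFinset_univ]

theorem trace_prodOp_conjTranspose_mul_self (A : LocalTuple d) :
    ((prodOp A).conjTranspose * prodOp A).trace = ((∏ i, hsSq (A i) : ℝ) : ℂ) := by
  rw [prodOp_conjTranspose, ← prodOp_mul, trace_prodOp, Complex.ofReal_prod]
  exact Finset.prod_congr rfl fun i _ => trace_conjTranspose_mul_self_eq_hsSq (A i)

theorem prodOp_smul (c : Fin n → ℂ) (A : LocalTuple d) :
    prodOp (fun i => c i • A i) = (∏ i, c i) • prodOp A := by
  ext x y
  simp [prodOp, Finset.prod_mul_distrib]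

theorem exists_normalized (hd : ∀ i, Nonempty (Fin (d i))) (K : LocalTuple d) :
    ∃ (c : ℝ) (L : LocalTuple d), 0 ≤ c ∧ (∀ i, hsSq (L i) = 1) ∧
      prodConj K = c • prodConj L ∧
      (prodOp K).conjTranspose * prodOp K = c • ((prodOp L).conjTranspose * prodOp L) := by
  choose t L hL hK using fun i => exists_smul_hsSq_eq_one (K i)
  have h : prodOp K = ((∏ i, t i : ℝ) : ℂ) • prodOp L := by
    rw [Complex.ofReal_prod, ← prodOp_smul]
    exact congrArg prodOp (funext hK)
  refine ⟨(∏ i, t i) ^ 2, L, by positivity, hL, ?_, ?_⟩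
  · refine LinearMap.ext fun X => ?_
    rw [prodConj_apply, h, LinearMap.smul_apply, prodConj_apply]
    ext x y
    simp [pow_two, mul_assoc]
  · rw [h]
    ext x y
    simp [pow_two, mul_assoc]

/-- Weights and normalized product operators describing a separable map with `m` Kraus operators. -/
def sepParams (d : Fin n → ℕ) (m : ℕ) : Set ((Fin m → ℝ) × (Fin m → LocalTuple d)) :=
  {p | p.1 ∈ stdSimplex ℝ (Fin m) ∧ (∀ a i, hsSq (p.2 a i) = 1) ∧
    ∑ a, ((Fintype.card (Idx d) : ℝ) * p.1 a) •
      ((prodOp (p.2 a)).conjTranspose * prodOp (p.2 a)) = 1}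

theorem continuous_prodOp : Continuous (prodOp : LocalTuple d → Op d) := by
  refine continuous_pi fun x => continuous_pi fun y => ?_
  simp only [prodOp, Matrix.of_apply]
  fun_prop

theorem isCompact_sepParams (m : ℕ) : IsCompact (sepParams d m) := by
  have hc : IsCompact (stdSimplex ℝ (Fin m) ×ˢ
      (Set.univ.pi fun _ : Fin m => Set.univ.pi fun i : Fin n =>
        {A : Matrix (Fin (d i)) (Fin (d i)) ℂ | hsSq A = 1})) :=
    (isCompact_stdSimplex ℝ (Fin m)).prod
      (isCompact_univ_pi fun _ => isCompact_univ_pi fun _ => isCompact_hsSq_eq_one)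
  have hcl : IsClosed {p : (Fin m → ℝ) × (Fin m → LocalTuple d) |
      ∑ a, ((Fintype.card (Idx d) : ℝ) * p.1 a) •
        ((prodOp (p.2 a)).conjTranspose * prodOp (p.2 a)) = 1} := by
    have h := continuous_prodOp (d := d)
    refine isClosed_eq ?_ continuous_const
    fun_prop
  convert hc.inter_right hcl using 1
  ext p
  simp [sepParams, and_assoc]

/-- The output on `ρ` of the map described by the parameters `p`. -/
noncomputable def sepOutput {m : ℕ} (ρ : Op d) (p : (Fin m → ℝ) × (Fin m → LocalTuple d)) : Op d :=
  ∑ a, ((Fintype.card (Idx d) : ℝ) * p.1 a) • prodConj (p.2 a) ρ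

theorem continuous_sepOutput {m : ℕ} (ρ : Op d) : Continuous (sepOutput (m := m) ρ) := by
  have h := continuous_prodOp (d := d)
  unfold sepOutput
  simp only [prodConj_apply]
  fun_prop

theorem exists_isSEP_of_sepParams (i₀ : Fin n) {m : ℕ} (ρ : Op d)
    {p : (Fin m → ℝ) × (Fin m → LocalTuple d)} (hp : p ∈ sepParams d m) :
    ∃ E : SuperOp d, IsSEP E ∧ E ρ = sepOutput ρ p := by
  obtain ⟨⟨hw, -⟩, -, h1⟩ := hp
  set t : Fin m → ℝ := fun a => (Fintype.card (Idx d) : ℝ) * p.1 a with ht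
  have ht0 : ∀ a, 0 ≤ t a := fun a => mul_nonneg (Nat.cast_nonneg _) (hw a)
  -- The whole weight √t is absorbed into the local operator of the single party `i₀`.
  set c : Fin m → Fin n → ℂ := fun a => Pi.mulSingle i₀ ((√(t a) : ℝ) : ℂ) with hc
  have hK : ∀ a, prodOp (fun i => c a i • p.2 a i) = ((√(t a) : ℝ) : ℂ) • prodOp (p.2 a) := by
    intro a
    rw [prodOp_smul, hc, Finset.prod_pi_mulSingle']
    simp
  have hsq : ∀ a, ((√(t a) : ℝ) : ℂ) * ((√(t a) : ℝ) : ℂ) = (t a : ℂ) := fun a => by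
    rw [← Complex.ofReal_mul, Real.mul_self_sqrt (ht0 a)]
  refine ⟨_, ⟨m, fun a i => c a i • p.2 a i, ?_, rfl⟩, ?_⟩
  · rw [← h1]
    refine Finset.sum_congr rfl fun a _ => ?_
    rw [hK]
    change _ = t a • _
    clear_value t
    ext x y
    simp [← mul_assoc, hsq]
  · rw [LinearMap.sum_apply, sepOutput]
    refine Finset.sum_congr rfl fun a _ => ?_
    change prodConj _ ρ = _
    rw [prodConj_apply, prodConj_apply, hK]
    change _ = t a • _
    clear_value t
    ext x y
    simp [← mul_assoc, hsq]

/-- Divided by the dimension, a separable map is a convex combination of normalized product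
conjugations. Carathéodory in the real space of superoperators then bounds the number of terms
independently of E. -/
theorem exists_sepParams_of_isSEP (hd : ∀ i, Nonempty (Fin (d i))) {E : SuperOp d} (hE : IsSEP E)
    (ρ : Op d) : ∃ m ≤ Module.finrank ℝ (Module.End ℂ (Op d)) + 1,
      ∃ p ∈ sepParams d m, sepOutput ρ p = E ρ := by
  obtain ⟨r, K, hK, hE⟩ := hE
  choose c L hc hL hKL hKL' using fun a => exists_normalized hd (K a)
  have hD : (0 : ℝ) < Fintype.card (Idx d) := by
    exact_mod_cast Fintype.card_pos
  set D : ℝ := (Fintype.card (Idx d) : ℝ) with hDdef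
  have htr : ∀ A : LocalTuple d, (∀ i, hsSq (A i) = 1) →
      ((prodOp A).conjTranspose * prodOp A).trace = 1 := fun A hA => by
    rw [trace_prodOp_conjTranspose_mul_self]; simp [hA]
  -- The trace of the completeness relation: each normalized term has trace 1, the identity has
  -- trace D.
  have hsum : ∑ a, c a = D := by
    have h := congrArg Matrix.trace hK
    rw [Matrix.trace_sum, Matrix.trace_one] at h
    simp only [hKL', Matrix.trace_smul, htr _ (hL _)] at h
    apply Complex.ofReal_injective
    simpa [hDdef] using h
  have hmem : D⁻¹ • E ∈ convexHull ℝ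
      {Φ : Module.End ℂ (Op d) | ∃ A : LocalTuple d, (∀ i, hsSq (A i) = 1) ∧ prodConj A = Φ} := by
    have h : D⁻¹ • E = ∑ a, (D⁻¹ * c a) • prodConj (L a) := by
      rw [hE, Finset.smul_sum]
      refine Finset.sum_congr rfl fun a _ => ?_
      rw [mul_smul, ← hKL]; rfl
    rw [h]
    refine (convex_convexHull ℝ _).sum_mem
      (fun a _ => mul_nonneg (inv_nonneg.2 hD.le) (hc a)) ?_
      fun a _ => subset_convexHull ℝ _ ⟨L a, hL a, rfl⟩
    rw [← Finset.mul_sum, hsum, inv_mul_cancel₀ hD.ne']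
  obtain ⟨ι, hι, z, w, hz, hind, hw, hw1, hwz⟩ := eq_pos_convex_span_of_mem_convexHull hmem
  have hcard := hind.card_le_finrank_succ
  choose A hA hAz using fun i => hz ⟨i, rfl⟩
  set e := (Fintype.equivFin ι).symm
  have hEsum : (∑ a, (D * w (e a)) • prodConj (A (e a)) : Module.End ℂ (Op d)) = E := by
    rw [Equiv.sum_comp e fun i => (D * w i) • prodConj (A i)]
    simp only [hAz, mul_smul, ← Finset.smul_sum, hwz]
    rw [smul_smul, mul_inv_cancel₀ hD.ne', one_smul]
  refine ⟨Fintype.card ι, hcard.trans (Nat.succ_le_succ (Submodule.finrank_le _)),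
    (fun a => w (e a), fun a => A (e a)), ⟨⟨fun a => (hw _).le, ?_⟩, fun a => hA _, ?_⟩, ?_⟩
  · rw [← hw1]; exact Equiv.sum_comp e w
  -- The new Kraus family is complete because it still represents the trace-preserving map E.
  · refine Matrix.ext_iff_trace_mul_right.2 fun X => ?_
    have htp : (E X).trace = X.trace := by
      have h := (sum_prodConj_tracePreserving_iff K).2 hK X
      rw [hE]; exact h
    rw [one_mul, ← htp, ← hEsum, LinearMap.sum_apply, Matrix.trace_sum, Finset.sum_mul,
      Matrix.trace_sum]
    refine Finset.sum_congr rfl fun a _ => ?_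
    rw [LinearMap.smul_apply, Matrix.trace_smul, trace_prodConj, Matrix.smul_mul,
      Matrix.trace_smul]
  · rw [← hEsum, LinearMap.sum_apply]
    rfl

theorem isClosed_setOf_isSEP_apply (i₀ : Fin n) (hd : ∀ i, Nonempty (Fin (d i))) (ρ : Op d) :
    IsClosed {σ : Op d | ∃ E : SuperOp d, IsSEP E ∧ E ρ = σ} := by
  have h : {σ : Op d | ∃ E : SuperOp d, IsSEP E ∧ E ρ = σ} =
      -- The Carathéodory bound finrank + 1 is itself allowed, hence + 2 in the range.
      ⋃ m ∈ Finset.range (Module.finrank ℝ (Module.End ℂ (Op d)) + 2),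
        sepOutput ρ '' sepParams d m := by
    ext σ
    simp only [Set.mem_ofPred_eq, Set.mem_iUnion, Finset.mem_range, Set.mem_image, exists_prop]
    constructor
    · rintro ⟨E, hE, rfl⟩
      obtain ⟨m, hm, p, hp, hpE⟩ := exists_sepParams_of_isSEP hd hE ρ
      exact ⟨m, by omega, p, hp, hpE⟩
    · rintro ⟨m, -, p, hp, rfl⟩
      exact exists_isSEP_of_sepParams i₀ ρ hp
  rw [h]
  exact isClosed_biUnion_finset fun m _ =>
    ((isCompact_sepParams m).image (continuous_sepOutput ρ)).isClosed

end SeparableClosed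

/-! ### Limits of LOCC transformations -/

section Limits

variable {n : ℕ} {d : Fin n → ℕ}

theorem nonempty_of_pureState (ψ : PureState d) (i : Fin n) : Nonempty (Fin (d i)) := by
  by_contra h
  have hemp : IsEmpty (Idx d) := ⟨fun x => h ⟨x i⟩⟩
  have h0 := sum_star_mul_self ψ
  simp at h0

/-- The output of a separable map on a pure state is a mixture of pure states. -/
theorem exists_mixture_of_sum_prodConj {ι : Type*} [Fintype ι] (K : ι → LocalTuple d)
    (hK : TracePreserving (∑ a, prodConj (K a) : Module.End ℂ (Op d))) (ψ : PureState d) :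
    ∃ (p : ι → ℝ) (χ : ι → PureState d), (∀ a, 0 ≤ p a) ∧ ∑ a, p a = 1 ∧
      ∀ a, prodConj (K a) ψ.dm = (p a : ℂ) • (χ a).dm := by
  choose p χ hp h using fun a => exists_prodConj_dm (K a) ψ
  refine ⟨p, χ, hp, ?_, h⟩
  have ht := hK ψ.dm
  rw [LinearMap.sum_apply, Matrix.trace_sum, trace_dm] at ht
  simp only [h, Matrix.trace_smul, trace_dm, smul_eq_mul, mul_one] at ht
  exact_mod_cast ht

theorem overlap_mixture_re {ι : Type*} [Fintype ι] (p : ι → ℝ) (χ : ι → PureState d)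
    (φ : PureState d) : (overlap φ (∑ a, (p a : ℂ) • (χ a).dm)).re =
      ∑ a, p a * (overlap (χ a) φ.dm).re := by
  rw [overlap_sum, Complex.re_sum]
  refine Finset.sum_congr rfl fun a _ => ?_
  rw [overlap_smul, Complex.re_ofReal_mul, overlap_dm_comm]

/-- Expanding the square gives tr ρ² − 2⟨φ|ρ|φ⟩ + 1, and tr ρ² is an average of overlaps ⟨χ|ρ|χ⟩,
each at most 1. -/
theorem hsSq_mixture_sub_dm_le {ι : Type*} [Fintype ι] {p : ι → ℝ} (hp : ∀ a, 0 ≤ p a)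
    (hp1 : ∑ a, p a = 1) (χ : ι → PureState d) (φ : PureState d) :
    hsSq ((∑ a, (p a : ℂ) • (χ a).dm) - φ.dm) ≤
      2 - 2 * (overlap φ (∑ a, (p a : ℂ) • (χ a).dm)).re := by
  set ρ : Op d := ∑ a, (p a : ℂ) • (χ a).dm with hρ
  have hherm : ρ.conjTranspose = ρ := by
    rw [hρ, Matrix.conjTranspose_sum]
    refine Finset.sum_congr rfl fun a _ => ?_
    rw [Matrix.conjTranspose_smul, dm_conjTranspose]
    simp
  have hov : ∀ φ : PureState d, (overlap φ ρ).re ≤ 1 := by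
    intro φ
    rw [hρ, overlap_mixture_re, ← hp1]
    exact Finset.sum_le_sum fun a _ =>
      mul_le_of_le_one_right (hp a) (overlap_dm_re_le_one _ _)
  have hsq : hsSq ρ ≤ 1 := by
    have h : hsSq ρ = ∑ a, p a * (overlap (χ a) ρ).re := by
      have h1 := trace_conjTranspose_mul_self_eq_hsSq ρ
      rw [hherm] at h1
      have h2 : (ρ * ρ).trace = ∑ a, (p a : ℂ) * overlap (χ a) ρ := by
        conv_lhs => rw [hρ, Finset.sum_mul, Matrix.trace_sum, ← hρ]
        refine Finset.sum_congr rfl fun a _ => ?_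
        rw [Matrix.smul_mul, Matrix.trace_smul, ← overlap_eq_trace, smul_eq_mul]
      rw [h2] at h1
      have h3 := congrArg Complex.re h1
      rw [Complex.re_sum, Complex.ofReal_re] at h3
      rw [← h3]
      exact Finset.sum_congr rfl fun a _ => Complex.re_ofReal_mul _ _
    rw [h, ← hp1]
    exact Finset.sum_le_sum fun a _ => mul_le_of_le_one_right (hp a) (hov _)
  rw [hsSq_sub_dm hherm]
  linarith

theorem tendsto_dm_of_overlap {ζ : ℕ → PureState d} {ψ : PureState d}
    (h : Tendsto (fun k => (overlap ψ (ζ k).dm).re) atTop (𝓝 1)) :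
    Tendsto (fun k => (ζ k).dm) atTop (𝓝 ψ.dm) := by
  apply tendsto_of_hsSq_sub
  have h1 : ∀ k, hsSq ((ζ k).dm - ψ.dm) = 2 - 2 * (overlap ψ (ζ k).dm).re := fun k => by
    rw [hsSq_sub_dm (dm_conjTranspose _), hsSq_dm]; ring
  simp only [h1]
  simpa using (h.const_mul 2).const_sub 2

theorem exists_unitary_seq_tendsto {ψ' ψ : PureState d} (h : 1 ≤ fidelityLU ψ'.dm ψ.dm) :
    ∃ (U : ℕ → ∀ i, Matrix.unitaryGroup (Fin (d i)) ℂ) (ζ : ℕ → PureState d),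
      (∀ k, prodConj (unitaryTuple (U k)) ψ.dm = (ζ k).dm) ∧
      Tendsto (fun k => (ζ k).dm) atTop (𝓝 ψ'.dm) := by
  have hk : ∀ k : ℕ, 1 - 1 / ((k : ℝ) + 1) < fidelityLU ψ'.dm ψ.dm := fun k => by
    have : 0 < 1 / ((k : ℝ) + 1) := Nat.one_div_pos_of_nat
    linarith
  choose U ζ hU hζ using fun k => exists_unitary_fidelityLU_lt ψ' ψ (hk k)
  refine ⟨U, ζ, hU, tendsto_dm_of_overlap ?_⟩
  refine tendsto_of_tendsto_of_tendsto_of_le_of_le ?_ tendsto_const_nhds (fun k => (hζ k).le)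
    fun k => overlap_dm_re_le_one _ _
  simpa using (tendsto_one_div_add_atTop_nhds_zero_nat (𝕜 := ℝ)).const_sub 1

theorem exists_party_of_mem_limitReachable {ψ φ : PureState d} (h : φ ∈ limitReachable ψ) :
    Nonempty (Fin n) := by
  obtain ⟨Λ, hΛ, -⟩ := h 1 one_pos
  exact exists_party_of_isLOCC hΛ

/-- Appending a final round of outcome-dependent local unitaries turns an approximate ensemble
transformation into an approximate state transformation by a finite-round protocol. -/
theorem exists_finiteRound_overlap {ψ φ : PureState d} (h : φ ∈ limitReachable ψ) {η : ℝ}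
    (hη : 0 < η) : ∃ Λ : SuperOp d, FiniteRound ⟨Unit, fun _ => Λ⟩ ∧
      1 - η < (overlap φ (Λ ψ.dm)).re := by
  obtain ⟨i₀⟩ := exists_party_of_mem_limitReachable h
  -- One third of η covers the ensemble defect, one third the near-optimal unitaries. The rest makes
  -- `hG` strict, so that it survives both approximations below.
  obtain ⟨⟨m, Λ⟩, hΛ, ψ', p, χ, hψ', ⟨hp, hp1, hout⟩, havg⟩ := h (η / 3) (by positivity)
  dsimp only at p χ hp hp1 hout havg hΛ
  have hlt : ∀ c, fidelityLU (χ c).dm φ.dm - η / 3 < fidelityLU (χ c).dm φ.dm := fun c => by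
    linarith
  choose V κ hV hκ using fun c => exists_unitary_fidelityLU_lt (χ c) φ (hlt c)
  have hG : 1 - η < (∑ c, overlap (κ c) (Λ c ψ'.dm)).re := by
    have h1 : (∑ c, overlap (κ c) (Λ c ψ'.dm)).re = ∑ c, p c * (overlap (χ c) (κ c).dm).re := by
      rw [Complex.re_sum]
      refine Finset.sum_congr rfl fun c _ => ?_
      rw [hout, overlap_smul, Complex.re_ofReal_mul, overlap_dm_comm]
    have h2 : ∑ c, p c * (fidelityLU (χ c).dm φ.dm - η / 3) ≤
        ∑ c, p c * (overlap (χ c) (κ c).dm).re :=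
      Finset.sum_le_sum fun c _ => mul_le_mul_of_nonneg_left (hκ c).le (hp c)
    have h3 : ∑ c, p c * (fidelityLU (χ c).dm φ.dm - η / 3) = avgFidelity p χ φ - η / 3 := by
      simp only [mul_sub, Finset.sum_sub_distrib, ← Finset.sum_mul, hp1, one_mul, avgFidelity]
    rw [h1]
    linarith
  obtain ⟨U, ζ, hU, hζ⟩ := exists_unitary_seq_tendsto (by simpa using hψ')
  have hcont : Continuous fun σ : Op d => (∑ c, overlap (κ c) (Λ c σ)).re :=
    Complex.continuous_re.comp (continuous_finsetSum _ fun c _ =>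
      (continuous_overlap (κ c)).comp (continuous_superOp (Λ c)))
  -- The strict bound is an open condition: ψ' is replaced by a local-unitary image of ψ, and then,
  -- with k fixed, Λ by a finite-round protocol.
  obtain ⟨k, hk⟩ := (((hcont.tendsto ψ'.dm).comp hζ).eventually (lt_mem_nhds hG)).exists
  obtain ⟨s, g, hs, hlim⟩ := exists_finiteRound_of_isLOCC hΛ
  have hlim' : Tendsto (fun ν => (∑ c, overlap (κ c) (coarse (s ν).J (g ν) c (ζ k).dm)).re) atTop
      (𝓝 (∑ c, overlap (κ c) (Λ c (ζ k).dm)).re) :=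
    (Complex.continuous_re.tendsto _).comp (tendsto_finsetSum _ fun c _ =>
      ((continuous_overlap (κ c)).tendsto _).comp (tendsto_apply_of_diamondNorm hlim (ζ k) c))
  obtain ⟨ν, hν⟩ := (hlim'.eventually (lt_mem_nhds hk)).exists
  have hpre := (hs ν).prepend_unitary i₀ (U k)
  -- The final round undoes V for the announced outcome and merges all outcomes into one.
  have hlink := linked_unitary i₀
    (fun o => ((s ν).J o : Module.End ℂ (Op d)) * prodConj (unitaryTuple (U k)))
    (fun o => (V (g ν o))⁻¹) (fun _ => ())
  rw [coarse_unit] at hlink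
  refine ⟨∑ o, prodConj (unitaryTuple (V (g ν o))⁻¹) *
    (((s ν).J o : Module.End ℂ (Op d)) * prodConj (unitaryTuple (U k))),
    FiniteRound.round hpre hlink, ?_⟩
  classical
  refine hν.trans_eq (congrArg Complex.re (Eq.symm ?_))
  rw [LinearMap.sum_apply, overlap_sum]
  simp only [coarse, LinearMap.sum_apply, overlap_sum, Finset.sum_filter]
  rw [Finset.sum_comm]
  refine Finset.sum_congr rfl fun o _ => ?_
  rw [Module.End.mul_apply, Module.End.mul_apply, hU,
    overlap_prodConj_unitary (V (g ν o)) _ (hV (g ν o)),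
    Finset.sum_eq_single (g ν o), if_pos rfl]
  · intro c _ hc
    rw [if_neg (Ne.symm hc), LinearMap.zero_apply]
    simp [overlap]
  · exact fun h => absurd (Finset.mem_univ _) h

theorem FiniteRound.hsSq_sub_dm_le {Λ : SuperOp d} (h : FiniteRound ⟨Unit, fun _ => Λ⟩)
    (ψ φ : PureState d) : hsSq (Λ ψ.dm - φ.dm) ≤ 2 - 2 * (overlap φ (Λ ψ.dm)).re := by
  obtain ⟨r, K, hK, hΛ⟩ := h.isSEP
  obtain ⟨p, χ, hp, hp1, hout⟩ :=
    exists_mixture_of_sum_prodConj K ((sum_prodConj_tracePreserving_iff K).2 hK) ψ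
  have h1 : Λ ψ.dm = ∑ a, (p a : ℂ) • (χ a).dm := by
    have h2 : Λ = ∑ a, prodConj (K a) := by
      rw [Finset.univ_unique, Finset.sum_singleton] at hΛ
      exact hΛ
    rw [h2, LinearMap.sum_apply]
    exact Finset.sum_congr rfl fun a _ => hout a
  rw [h1]
  exact hsSq_mixture_sub_dm_le hp hp1 χ φ

theorem exists_finiteRound_seq {ψ φ : PureState d} (h : φ ∈ limitReachable ψ) :
    ∃ Λ : ℕ → SuperOp d, (∀ i, FiniteRound ⟨Unit, fun _ => Λ i⟩) ∧
      Tendsto (fun i => hsSq (Λ i ψ.dm - φ.dm)) atTop (𝓝 0) := by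
  choose Λ hΛ hov using fun k : ℕ =>
    exists_finiteRound_overlap h (Nat.one_div_pos_of_nat (α := ℝ) (n := k))
  refine ⟨Λ, hΛ, squeeze_zero (fun _ => hsSq_nonneg _)
    (g := fun k : ℕ => 2 * (1 / ((k : ℝ) + 1))) (fun k => ?_) ?_⟩
  · have h1 := (hΛ k).hsSq_sub_dm_le ψ φ
    have h2 := hov k
    linarith
  · simpa using (tendsto_one_div_add_atTop_nhds_zero_nat (𝕜 := ℝ)).const_mul 2

theorem exists_isLOCCMap_seq {ψ φ : PureState d} (h : φ ∈ limitReachable ψ) :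
    ∃ Λ : ℕ → SuperOp d, (∀ i, IsLOCCMap (Λ i)) ∧
      Tendsto (fun i => traceDist (Λ i ψ.dm) φ.dm) atTop (𝓝 0) := by
  obtain ⟨i₀⟩ := exists_party_of_mem_limitReachable h
  obtain ⟨Λ, hΛ, ht⟩ := exists_finiteRound_seq h
  refine ⟨Λ, fun i => ?_, ?_⟩
  · have h1 := (hΛ i).isLOCC i₀ (id : Unit → Unit)
    rw [coarse_id] at h1
    exact h1
  · simpa only [traceDist, mul_zero] using (tendsto_traceNorm_sub_of_hsSq ht).const_mul (1 / 2)

/-- The maps themselves need not converge; only their outputs on ψ do, and these lie in a closed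
set. -/
theorem exists_isSEP_of_mem_limitReachable {ψ φ : PureState d} (h : φ ∈ limitReachable ψ) :
    ∃ E : SuperOp d, IsSEP E ∧ E ψ.dm = φ.dm := by
  obtain ⟨i₀⟩ := exists_party_of_mem_limitReachable h
  obtain ⟨Λ, hΛ, ht⟩ := exists_finiteRound_seq h
  refine (isClosed_setOf_isSEP_apply i₀ (nonempty_of_pureState ψ) ψ.dm).mem_of_tendsto
    (tendsto_of_hsSq_sub ht) (Eventually.of_forall fun i => ⟨Λ i, ?_, rfl⟩)
  simpa using (hΛ i).isSEP

/-- Announcing all Kraus outcomes of a finite-round approximation of an LOCC map yields an ensemble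
of pure states. -/
theorem mem_limitReachable_of_seq {ψ φ : PureState d} {Λ : ℕ → SuperOp d}
    (hΛ : ∀ i, IsLOCCMap (Λ i))
    (h : Tendsto (fun i => traceDist (Λ i ψ.dm) φ.dm) atTop (𝓝 0)) :
    φ ∈ limitReachable ψ := by
  intro ε hε
  have h1 : Tendsto (fun i => traceNorm (Λ i ψ.dm - φ.dm)) atTop (𝓝 0) := by
    simpa [traceDist] using h.const_mul 2
  have hφ : 1 - ε < (overlap φ φ.dm).re := by
    rw [overlap_dm_self, Complex.one_re]; linarith
  have hcont : Continuous fun σ : Op d => (overlap φ σ).re :=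
    Complex.continuous_re.comp (continuous_overlap φ)
  obtain ⟨i, hi⟩ := (((hcont.tendsto φ.dm).comp (tendsto_of_traceNorm_sub h1)).eventually
    (lt_mem_nhds hφ)).exists
  obtain ⟨i₀⟩ := exists_party_of_isLOCC (hΛ i)
  obtain ⟨s, g, hs, hlim⟩ := exists_finiteRound_of_isLOCC (hΛ i)
  obtain ⟨ν, hν⟩ := (((hcont.tendsto _).comp
    (tendsto_apply_of_diamondNorm hlim ψ ())).eventually (lt_mem_nhds hi)).exists
  -- With one product Kraus operator per outcome, every branch sends ψ to a multiple of a pure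
  -- state, while the total map is unchanged.
  obtain ⟨O', hO', K, f, hK, hJ⟩ := (hs ν).refinable
  have hsum : coarse (s ν).J (g ν) () = ∑ a, prodConj (K a) := by
    rw [coarse_unit, hJ, sum_coarse]
  obtain ⟨p, χ, hp, hp1, hout⟩ := exists_mixture_of_sum_prodConj K hK.tracePreserving ψ
  have hne : Nonempty O' := by
    by_contra hemp
    rw [not_nonempty_iff] at hemp
    simp at hp1
  set e := Fintype.equivFin O'
  have : Nonempty (Fin (Fintype.card O')) := ⟨e (Classical.arbitrary O')⟩
  have hJe : ∀ c, coarse (fun a => prodConj (K a)) e c = prodConj (K (e.symm c)) := by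
    classical
    intro c
    rw [coarse, Finset.sum_filter, Finset.sum_eq_single (e.symm c)]
    · simp
    · intro a _ ha
      rw [if_neg fun hc => ha (by rw [← hc, e.symm_apply_apply])]
    · simp
  -- Here δ = 0 is met with ψ itself as the initial state.
  refine ⟨⟨Fintype.card O', coarse (fun a => prodConj (K a)) e⟩, hK.isLOCC i₀ e, ψ,
    fun c => p (e.symm c), fun c => χ (e.symm c), ?_, ⟨fun c => hp _, ?_, fun c => ?_⟩, ?_⟩
  · have h2 := overlap_le_fidelityLU ψ ψ
    rw [overlap_dm_self, Complex.one_re] at h2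
    linarith
  · rw [← hp1]; exact Equiv.sum_comp e.symm p
  · exact (congrArg (fun Φ : SuperOp d => Φ ψ.dm) (hJe c)).trans (hout _)
  · have h2 : (overlap φ (coarse (s ν).J (g ν) () ψ.dm)).re =
        ∑ a, p a * (overlap (χ a) φ.dm).re := by
      rw [← overlap_mixture_re, hsum, LinearMap.sum_apply]
      congr 2
      exact Finset.sum_congr rfl fun a _ => hout a
    have h3 : avgFidelity (fun c => p (e.symm c)) (fun c => χ (e.symm c)) φ =
        ∑ a, p a * fidelityLU (χ a).dm φ.dm :=
      Equiv.sum_comp e.symm fun a => p a * fidelityLU (χ a).dm φ.dm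
    have h4 : ∑ a, p a * (overlap (χ a) φ.dm).re ≤ ∑ a, p a * fidelityLU (χ a).dm φ.dm :=
      Finset.sum_le_sum fun a _ => mul_le_mul_of_nonneg_left (overlap_le_fidelityLU _ _) (hp a)
    simp only [Function.comp_apply] at hν
    rw [h3]
    linarith

end Limits

theorem mainTheorem7 {n : ℕ} (d : Fin n → ℕ) (ψ : PureState d) :
    limitReachable ψ =
        {φ : PureState d | ∃ Λ : ℕ → SuperOp d, (∀ i, IsLOCCMap (Λ i)) ∧
          Tendsto (fun i => traceDist (Λ i ψ.dm) φ.dm) atTop (𝓝 0)} ∧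
      limitReachable ψ ⊆
        {φ : PureState d | ∃ E : SuperOp d, IsSEP E ∧ E ψ.dm = φ.dm} := by
  refine ⟨Set.Subset.antisymm (fun φ h => exists_isLOCCMap_seq h) ?_,
    fun φ h => exists_isSEP_of_mem_limitReachable h⟩
  rintro φ ⟨Λ, hΛ, h⟩
  exact mem_limitReachable_of_seq hΛ h
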